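/- Let $X_1,X_2,\ldots$ be independent copies of a random factor $X$ with an arbitrary distribution on the open interval $]0,1[$, and let $E_1,E_2,\ldots$ be i.i.d. unit exponential variables (with positive values) independent of the $X_j$'s. Fix $r_0>0$ and a horizon $T\ge 0$. Let $R=(R_t)_{t\ge 0}$ be the nonincreasing right-continuous pure-jump process with $R_0=r_0$ that visits the states $r_0,\ r_0X_1,\ r_0X_1X_2,\ldots$ in this order and stays in them for the times $E_1/r_0,\ E_2/(r_0X_1),\ E_3/(r_0X_1X_2),\ldots$ respectively. The jump times of $R$ are called record times. A policy is a stopping time $\pi$, with values in $[0,\infty]$, of the right-continuous natural filtration of $R$; its success probability is $$\mathbb P(R_{\pi-}>R_\pi=R_T,\ \pi<T),$$ the probability that $\pi$ is the last record time before $T$. For $s>0$ let $\pi_s$ be the first record time $t$ with $(T-t)R_t\le s$ (and $\pi_s=\infty$ if there is none). **Proposition.** The equation $$\mathbb E\left[\frac{e^{s(1-X)}-1}{1-X}\right]=1$$ has a unique positive root $s_*$. The random time $\pi_{s_*}$ is a policy, and it is optimal: no policy has a larger success probability than $\pi_{s_*}$. -/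

import Mathlib

open MeasureTheory ProbabilityTheory
open scoped NNReal

noncomputable section

/-- The weight of the `n`-th record, `r₀ X₁ ⋯ Xₙ`. The factors `X₁, X₂, …` are indexed as
`X 0, X 1, …`; for `n = 0` this is the initial state `r₀` (which is not a record). -/
def recordWeight {Ω : Type*} (r₀ : ℝ) (X : ℕ → Ω → ℝ) (n : ℕ) (ω : Ω) : ℝ :=
  r₀ * ∏ j ∈ Finset.range n, X j ω

/-- The time of the `n`-th record: the sum of the first `n` sojourns
`E₁ / r₀, E₂ / (r₀ X₁), E₃ / (r₀ X₁ X₂), …` (with `E₁, E₂, …` indexed as `E 0, E 1, …`). -/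
def recordTime {Ω : Type*} (r₀ : ℝ) (X E : ℕ → Ω → ℝ) (n : ℕ) (ω : Ω) : ℝ :=
  ∑ k ∈ Finset.range n, E k ω / recordWeight r₀ X k ω

/-- The record process `R`: `R t ω` is the weight of the latest record up to time `t`, and `r₀`
if there was none. The weights decrease, so it is the least weight attained up to time `t`; see
`recordProcess_eq`. If the record times accumulate before `t` (which has probability zero), the
process sits at the limit of the weights. -/
def recordProcess {Ω : Type*} (r₀ : ℝ) (X E : ℕ → Ω → ℝ) (t : ℝ≥0) (ω : Ω) : ℝ :=
  ⨅ n : ℕ, if recordTime r₀ X E n ω ≤ t then recordWeight r₀ X n ω else r₀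

/-- On the `n`-th sojourn interval the process equals the `n`-th weight. -/
theorem recordProcess_eq {Ω : Type*} {r₀ : ℝ} (hr₀ : 0 < r₀) {X E : ℕ → Ω → ℝ} {ω : Ω}
    (hX : ∀ j, X j ω ∈ Set.Ioo (0 : ℝ) 1) (hE : ∀ j, 0 < E j ω) {t : ℝ≥0} {n : ℕ}
    (h₁ : recordTime r₀ X E n ω ≤ t) (h₂ : t < recordTime r₀ X E (n + 1) ω) :
    recordProcess r₀ X E t ω = recordWeight r₀ X n ω := by
  have hpos : ∀ k, 0 < recordWeight r₀ X k ω := fun k =>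
    mul_pos hr₀ (Finset.prod_pos fun j _ => (hX j).1)
  have hanti : Antitone fun k => recordWeight r₀ X k ω := by
    refine antitone_nat_of_succ_le fun k => ?_
    have := mul_le_mul_of_nonneg_left (hX k).2.le (hpos k).le
    simpa [recordWeight, Finset.prod_range_succ, mul_assoc] using this
  have hmono : Monotone fun k => recordTime r₀ X E k ω := by
    refine monotone_nat_of_le_succ fun k => ?_
    have := div_pos (hE k) (hpos k)
    simp only [recordTime, Finset.sum_range_succ]
    linarith
  have hr : ∀ k, recordWeight r₀ X k ω ≤ r₀ := fun k => by
    simpa [recordWeight] using hanti (Nat.zero_le k)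
  have hle : ∀ k, recordWeight r₀ X n ω ≤
      if recordTime r₀ X E k ω ≤ t then recordWeight r₀ X k ω else r₀ := by
    intro k
    split_ifs with h
    · refine hanti ?_
      by_contra! hk
      exact absurd (hmono (show n + 1 ≤ k from hk)) (not_le.2 (h.trans_lt h₂))
    · exact hr n
  refine le_antisymm ?_ (le_ciInf hle)
  have := ciInf_le (f := fun k => if recordTime r₀ X E k ω ≤ t then recordWeight r₀ X k ω else r₀)
    ⟨_, Set.forall_mem_range.2 hle⟩ n
  simpa [recordProcess, h₁] using this

theorem measurable_recordProcess {Ω : Type*} [MeasurableSpace Ω] (r₀ : ℝ) {X E : ℕ → Ω → ℝ}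
    (hX : ∀ j, Measurable (X j)) (hE : ∀ j, Measurable (E j)) (t : ℝ≥0) :
    Measurable (recordProcess r₀ X E t) := by
  have hW : ∀ n, Measurable (recordWeight r₀ X n) := fun n =>
    (Finset.measurable_fun_prod _ fun j _ => hX j).const_mul r₀
  have hT : ∀ n, Measurable (recordTime r₀ X E n) := fun n =>
    Finset.measurable_fun_sum _ fun k _ => (hE k).div (hW k)
  exact Measurable.iInf fun n =>
    Measurable.ite (measurableSet_le (hT n) measurable_const) (hW n) measurable_const

/-- The natural filtration of `R`, made right-continuous. -/
def recordFiltration {Ω : Type*} [mΩ : MeasurableSpace Ω] (r₀ : ℝ) {X E : ℕ → Ω → ℝ}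
    (hX : ∀ j, Measurable (X j)) (hE : ∀ j, Measurable (E j)) : Filtration ℝ≥0 mΩ :=
  (Filtration.natural (recordProcess r₀ X E)
    fun t => (measurable_recordProcess r₀ hX hE t).stronglyMeasurable).rightCont

/-- A record occurs at time `t`: the path `R` jumps down, `R (t-) > R t`.
(At `t = 0` the left limit is `R 0` by convention, so `0` is never a record time.) -/
def IsRecordTime (R : ℝ≥0 → ℝ) (t : ℝ≥0) : Prop :=
  R t < Function.leftLim R t

/-- The probability that the policy `π` recognises the last record before the horizon `T`:
`P (R_{π-} > R_π = R_T, π < T)`. The value `⊤` means that `π` never stops. -/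
def successProb {Ω : Type*} [MeasurableSpace Ω] (P : Measure Ω) (R : ℝ≥0 → Ω → ℝ) (T : ℝ≥0)
    (π : Ω → WithTop ℝ≥0) : ℝ :=
  P.real {ω | ∃ t : ℝ≥0, π ω = t ∧ t < T ∧ IsRecordTime (fun u => R u ω) t ∧ R t ω = R T ω}

/-- The policy `π_s`: stop at the first record time `t` with `(T - t) R_t ≤ s`. -/
def thresholdPolicy {Ω : Type*} (R : ℝ≥0 → Ω → ℝ) (T : ℝ≥0) (s : ℝ) (ω : Ω) : WithTop ℝ≥0 :=
  sInf {τ | ∃ t : ℝ≥0, τ = t ∧ IsRecordTime (fun u => R u ω) t ∧ ((T : ℝ) - t) * R t ω ≤ s}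

end

open Filter Topology

/-! ### Pathwise description of the records and their loads. -/

section Paths

variable {Ω : Type*} {r₀ : ℝ} {X E : ℕ → Ω → ℝ} {ω : Ω}

/-! Everything reduces to the load Yₙ = (T - Tₙ) Wₙ at the `n`-th record, a Markov chain with Yₙ₊₁ =
(Yₙ - Eₙ) Xₙ in the zero-based indexing of `E` and `X` (`recordLoad_succ`). The next record misses
the horizon iff Eₙ > Yₙ, so stopping at a record with load y succeeds with conditional probability
g(y) = e^{-y} for y > 0 and g(y) = 0 otherwise (`stopGain`).

Integrating out (Eₙ, Xₙ) gives E[g(Yₙ₊₁) | past] = g(Yₙ) Φ(Yₙ) with Φ(y) = E[(e^{y(1-X)} - 1)/(1 -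
X)] (`integral_stopGain_prod`). On y ≥ 0 the function Φ is continuous with Φ(0) = 0 and grows at
rate at least 1, so Φ = 1 has a unique positive root s, and waiting for one more record is
favourable iff the load exceeds s. A load that is at most s stays so (`recordLoad_succ_le`): this is
the monotone case of optimal stopping.

The comparison runs forward. If stopping is forced at record n + 1, allowing one record more changes
the expected gain by E[p g(Yₙ₊₁)(Φ(Yₙ₊₁) - 1)], where p indicates that the policy has passed the
first n + 1 records. For the threshold policy p is exactly the indicator of Yₙ₊₁ > s, which
maximises the integrand pointwise among all p in [0, 1]. Truncation costs at most P(Yₙ₊₁ > 0), which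
tends to 0.

For an arbitrary stopping time of the right-continuous filtration, the decision to stop at a given
record must depend only on the factors and sojourns up to that record
(`measurableSet_eq_recordTimeNN`). -/

theorem recordWeight_pos (hr₀ : 0 < r₀) (hX : ∀ j, X j ω ∈ Set.Ioo (0 : ℝ) 1) (n : ℕ) :
    0 < recordWeight r₀ X n ω :=
  mul_pos hr₀ (Finset.prod_pos fun j _ => (hX j).1)

theorem recordWeight_zero : recordWeight r₀ X 0 ω = r₀ := by simp [recordWeight]

theorem recordWeight_succ (n : ℕ) :
    recordWeight r₀ X (n + 1) ω = recordWeight r₀ X n ω * X n ω := by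
  simp [recordWeight, Finset.prod_range_succ, mul_assoc]

theorem recordWeight_strictAnti (hr₀ : 0 < r₀) (hX : ∀ j, X j ω ∈ Set.Ioo (0 : ℝ) 1) :
    StrictAnti fun n => recordWeight r₀ X n ω := by
  refine strictAnti_nat_of_succ_lt fun n => ?_
  rw [recordWeight_succ]
  exact mul_lt_of_lt_one_right (recordWeight_pos hr₀ hX n) (hX n).2

theorem recordTime_zero : recordTime r₀ X E 0 ω = 0 := by simp [recordTime]

theorem recordTime_succ (n : ℕ) :
    recordTime r₀ X E (n + 1) ω = recordTime r₀ X E n ω + E n ω / recordWeight r₀ X n ω := by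
  simp [recordTime, Finset.sum_range_succ]

theorem recordTime_strictMono (hr₀ : 0 < r₀) (hX : ∀ j, X j ω ∈ Set.Ioo (0 : ℝ) 1)
    (hE : ∀ j, 0 < E j ω) : StrictMono fun n => recordTime r₀ X E n ω := by
  refine strictMono_nat_of_lt_succ fun n => ?_
  rw [recordTime_succ]
  have := div_pos (hE n) (recordWeight_pos hr₀ hX n)
  linarith

theorem recordTime_nonneg (hr₀ : 0 < r₀) (hX : ∀ j, X j ω ∈ Set.Ioo (0 : ℝ) 1)
    (hE : ∀ j, 0 < E j ω) (n : ℕ) : 0 ≤ recordTime r₀ X E n ω :=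
  recordTime_zero.ge.trans ((recordTime_strictMono hr₀ hX hE).monotone n.zero_le)

theorem bddBelow_recordProcess (hr₀ : 0 < r₀) (hX : ∀ j, X j ω ∈ Set.Ioo (0 : ℝ) 1) (t : ℝ≥0) :
    BddBelow (Set.range fun n : ℕ =>
      if recordTime r₀ X E n ω ≤ t then recordWeight r₀ X n ω else r₀) := by
  refine ⟨0, Set.forall_mem_range.2 fun n => ?_⟩
  split_ifs
  exacts [(recordWeight_pos hr₀ hX n).le, hr₀.le]

theorem recordProcess_le_recordWeight (hr₀ : 0 < r₀) (hX : ∀ j, X j ω ∈ Set.Ioo (0 : ℝ) 1)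
    {t : ℝ≥0} {n : ℕ} (h : recordTime r₀ X E n ω ≤ t) :
    recordProcess r₀ X E t ω ≤ recordWeight r₀ X n ω := by
  have := ciInf_le (bddBelow_recordProcess (E := E) hr₀ hX t) n
  simpa [recordProcess, h] using this

theorem recordProcess_antitone (hr₀ : 0 < r₀) (hX : ∀ j, X j ω ∈ Set.Ioo (0 : ℝ) 1) :
    Antitone fun t => recordProcess r₀ X E t ω := by
  intro s t hst
  refine le_ciInf fun n => ?_
  split_ifs with h
  · exact recordProcess_le_recordWeight hr₀ hX (h.trans (by exact_mod_cast hst))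
  · have := recordProcess_le_recordWeight (E := E) (t := t) hr₀ hX (n := 0)
      (by rw [recordTime_zero]; exact t.2)
    rwa [recordWeight_zero] at this

/-- The record time as a nonnegative real. -/
noncomputable def recordTimeNN (r₀ : ℝ) (X E : ℕ → Ω → ℝ) (n : ℕ) (ω : Ω) : ℝ≥0 :=
  (recordTime r₀ X E n ω).toNNReal

theorem coe_recordTimeNN (hr₀ : 0 < r₀) (hX : ∀ j, X j ω ∈ Set.Ioo (0 : ℝ) 1)
    (hE : ∀ j, 0 < E j ω) (n : ℕ) :
    (recordTimeNN r₀ X E n ω : ℝ) = recordTime r₀ X E n ω :=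
  Real.coe_toNNReal _ (recordTime_nonneg hr₀ hX hE n)

theorem recordTimeNN_zero : recordTimeNN r₀ X E 0 ω = 0 := by
  simp [recordTimeNN, recordTime_zero]

theorem recordTimeNN_strictMono (hr₀ : 0 < r₀) (hX : ∀ j, X j ω ∈ Set.Ioo (0 : ℝ) 1)
    (hE : ∀ j, 0 < E j ω) : StrictMono fun n => recordTimeNN r₀ X E n ω := by
  intro m n hmn
  rw [← NNReal.coe_lt_coe, coe_recordTimeNN hr₀ hX hE, coe_recordTimeNN hr₀ hX hE]
  exact recordTime_strictMono hr₀ hX hE hmn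

theorem recordProcess_eq_recordWeight (hr₀ : 0 < r₀) (hX : ∀ j, X j ω ∈ Set.Ioo (0 : ℝ) 1)
    (hE : ∀ j, 0 < E j ω) {t : ℝ≥0} {n : ℕ} (h₁ : recordTimeNN r₀ X E n ω ≤ t)
    (h₂ : t < recordTimeNN r₀ X E (n + 1) ω) :
    recordProcess r₀ X E t ω = recordWeight r₀ X n ω := by
  rw [← NNReal.coe_le_coe, coe_recordTimeNN hr₀ hX hE] at h₁
  rw [← NNReal.coe_lt_coe, coe_recordTimeNN hr₀ hX hE] at h₂
  exact recordProcess_eq hr₀ hX hE h₁ h₂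

theorem recordProcess_le_of_recordTimeNN_le (hr₀ : 0 < r₀)
    (hX : ∀ j, X j ω ∈ Set.Ioo (0 : ℝ) 1) (hE : ∀ j, 0 < E j ω) {t : ℝ≥0} {n : ℕ}
    (h : recordTimeNN r₀ X E n ω ≤ t) :
    recordProcess r₀ X E t ω ≤ recordWeight r₀ X n ω := by
  rw [← NNReal.coe_le_coe, coe_recordTimeNN hr₀ hX hE] at h
  exact recordProcess_le_recordWeight hr₀ hX h

/-- The jump times of the record process are the record times with positive index. -/
theorem isRecordTime_iff (hr₀ : 0 < r₀) (hX : ∀ j, X j ω ∈ Set.Ioo (0 : ℝ) 1)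
    (hE : ∀ j, 0 < E j ω) {t : ℝ≥0} :
    IsRecordTime (fun u => recordProcess r₀ X E u ω) t ↔
      ∃ n, t = recordTimeNN r₀ X E (n + 1) ω := by
  have hanti := recordProcess_antitone (E := E) hr₀ hX
  have hmono := recordTimeNN_strictMono hr₀ hX hE
  constructor
  · intro h
    by_contra! hne
    refine absurd h (not_lt.2 ?_)
    rcases eq_or_ne t 0 with rfl | ht
    -- Nothing lies to the left of `0`, so `leftLim` takes the value there and no jump is seen.
    · rw [leftLim_eq_of_isBot (fun x => zero_le)]
    have ht0 : 0 < t := pos_iff_ne_zero.2 ht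
    -- Each record up to `t` happens strictly before `t`, so the left limit is already below its
    -- weight. Comparing with every term of the infimum also covers accumulation of records before
    -- or at `t`.
    refine le_ciInf fun n => ?_
    split_ifs with hn
    · have hn' : recordTimeNN r₀ X E n ω ≤ t := by
        rwa [← NNReal.coe_le_coe, coe_recordTimeNN hr₀ hX hE]
      have hlt : recordTimeNN r₀ X E n ω < t := by
        rcases n with _ | n
        · rwa [recordTimeNN_zero]
        · exact lt_of_le_of_ne hn' (hne n).symm
      exact (hanti.leftLim_le hlt).trans
        (recordProcess_le_of_recordTimeNN_le hr₀ hX hE le_rfl)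
    · refine (hanti.leftLim_le ht0).trans ?_
      have := recordProcess_le_of_recordTimeNN_le hr₀ hX hE (t := 0) (n := 0)
        recordTimeNN_zero.le
      rwa [recordWeight_zero] at this
  · rintro ⟨n, rfl⟩
    have h1 : recordTimeNN r₀ X E n ω < recordTimeNN r₀ X E (n + 1) ω := hmono n.lt_succ_self
    have h2 : Function.leftLim (fun u => recordProcess r₀ X E u ω)
        (recordTimeNN r₀ X E (n + 1) ω) = recordWeight r₀ X n ω := by
      have : (𝓝[<] (recordTimeNN r₀ X E (n + 1) ω)).NeBot :=
        nhdsLT_neBot_of_exists_lt ⟨_, h1⟩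
      refine leftLim_eq_of_tendsto (tendsto_const_nhds.congr' ?_)
      filter_upwards [Ico_mem_nhdsLT h1] with u hu
      exact (recordProcess_eq_recordWeight hr₀ hX hE hu.1 hu.2).symm
    rw [IsRecordTime, h2, recordProcess_eq_recordWeight hr₀ hX hE le_rfl
      (hmono (n + 1).lt_succ_self)]
    exact recordWeight_strictAnti hr₀ hX n.lt_succ_self

/-- The expected number of records in the time that remains after the `n`-th record, if all of
them had the current weight: `(T - Tₙ) Wₙ`. -/
noncomputable def recordLoad (r₀ : ℝ) (X E : ℕ → Ω → ℝ) (T : ℝ) (n : ℕ) (ω : Ω) : ℝ :=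
  (T - recordTime r₀ X E n ω) * recordWeight r₀ X n ω

theorem recordLoad_zero (T : ℝ) : recordLoad r₀ X E T 0 ω = T * r₀ := by
  simp [recordLoad, recordTime_zero, recordWeight_zero]

/-- The Markov recursion: a fresh sojourn and factor enter, while `T` and `r₀` matter only through
the initial load. -/
theorem recordLoad_succ (hr₀ : 0 < r₀) (hX : ∀ j, X j ω ∈ Set.Ioo (0 : ℝ) 1) (T : ℝ) (n : ℕ) :
    recordLoad r₀ X E T (n + 1) ω = (recordLoad r₀ X E T n ω - E n ω) * X n ω := by
  have := (recordWeight_pos hr₀ hX n).ne'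
  simp only [recordLoad, recordTime_succ, recordWeight_succ]
  field_simp
  ring

/-- Small loads are absorbing. A negative load may move up towards `0`, which is why `0 ≤ s` is
needed. -/
theorem recordLoad_succ_le (hr₀ : 0 < r₀) (hX : ∀ j, X j ω ∈ Set.Ioo (0 : ℝ) 1)
    (hE : ∀ j, 0 < E j ω) {T s : ℝ} (hs : 0 ≤ s) {n : ℕ} (h : recordLoad r₀ X E T n ω ≤ s) :
    recordLoad r₀ X E T (n + 1) ω ≤ s := by
  rw [recordLoad_succ hr₀ hX]
  have h1 := hX n
  have h2 := hE n
  rcases le_or_gt (recordLoad r₀ X E T n ω - E n ω) 0 with h3 | h3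
  · exact (mul_nonpos_of_nonpos_of_nonneg h3 h1.1.le).trans hs
  · exact (mul_le_of_le_one_right h3.le h1.2.le).trans (by linarith)

theorem recordLoad_le_of_le (hr₀ : 0 < r₀) (hX : ∀ j, X j ω ∈ Set.Ioo (0 : ℝ) 1)
    (hE : ∀ j, 0 < E j ω) {T s : ℝ} (hs : 0 ≤ s) {m n : ℕ} (hmn : m ≤ n)
    (h : recordLoad r₀ X E T m ω ≤ s) : recordLoad r₀ X E T n ω ≤ s := by
  induction n, hmn using Nat.le_induction with
  | base => exact h
  | succ n _ ih => exact recordLoad_succ_le hr₀ hX hE hs ih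

theorem recordLoad_pos_iff (hr₀ : 0 < r₀) (hX : ∀ j, X j ω ∈ Set.Ioo (0 : ℝ) 1)
    (hE : ∀ j, 0 < E j ω) {T : ℝ≥0} {n : ℕ} :
    0 < recordLoad r₀ X E T n ω ↔ recordTimeNN r₀ X E n ω < T := by
  rw [recordLoad, mul_pos_iff_of_pos_right (recordWeight_pos hr₀ hX n), sub_pos,
    ← NNReal.coe_lt_coe, coe_recordTimeNN hr₀ hX hE]

theorem recordLoad_lt_iff (hr₀ : 0 < r₀) (hX : ∀ j, X j ω ∈ Set.Ioo (0 : ℝ) 1)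
    (hE : ∀ j, 0 < E j ω) {T : ℝ≥0} {n : ℕ} :
    recordLoad r₀ X E T n ω < E n ω ↔ T < recordTimeNN r₀ X E (n + 1) ω := by
  rw [← NNReal.coe_lt_coe, coe_recordTimeNN hr₀ hX hE, recordTime_succ, recordLoad,
    ← lt_div_iff₀ (recordWeight_pos hr₀ hX n), sub_lt_iff_lt_add']

/-- A policy succeeds when it stops at a record before the horizon and no record follows before
the horizon. -/
theorem success_iff (hr₀ : 0 < r₀) (hX : ∀ j, X j ω ∈ Set.Ioo (0 : ℝ) 1)
    (hE : ∀ j, 0 < E j ω) {T : ℝ≥0} {τ : WithTop ℝ≥0} :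
    (∃ t : ℝ≥0, τ = t ∧ t < T ∧ IsRecordTime (fun u => recordProcess r₀ X E u ω) t ∧
      recordProcess r₀ X E t ω = recordProcess r₀ X E T ω) ↔
    ∃ n, τ = recordTimeNN r₀ X E (n + 1) ω ∧ 0 < recordLoad r₀ X E T (n + 1) ω ∧
      recordLoad r₀ X E T (n + 1) ω < E (n + 1) ω := by
  have hmono := recordTimeNN_strictMono hr₀ hX hE
  constructor
  · rintro ⟨t, rfl, htT, ht, hR⟩
    obtain ⟨n, rfl⟩ := (isRecordTime_iff hr₀ hX hE).1 ht
    refine ⟨n, rfl, (recordLoad_pos_iff hr₀ hX hE).2 htT, (recordLoad_lt_iff hr₀ hX hE).2 ?_⟩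
    by_contra! hle
    have h1 := recordProcess_le_of_recordTimeNN_le hr₀ hX hE hle
    rw [← hR, recordProcess_eq_recordWeight hr₀ hX hE le_rfl (hmono (n + 1).lt_succ_self)] at h1
    exact absurd (recordWeight_strictAnti hr₀ hX (n + 1).lt_succ_self) (not_lt.2 h1)
  · rintro ⟨n, h, h1, h2⟩
    have h1' := (recordLoad_pos_iff hr₀ hX hE).1 h1
    refine ⟨_, h, h1', (isRecordTime_iff hr₀ hX hE).2 ⟨n, rfl⟩, ?_⟩
    rw [recordProcess_eq_recordWeight hr₀ hX hE le_rfl (hmono (n + 1).lt_succ_self),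
      recordProcess_eq_recordWeight hr₀ hX hE h1'.le ((recordLoad_lt_iff hr₀ hX hE).1 h2)]

theorem mul_recordProcess_recordTimeNN (hr₀ : 0 < r₀) (hX : ∀ j, X j ω ∈ Set.Ioo (0 : ℝ) 1)
    (hE : ∀ j, 0 < E j ω) (T : ℝ) (n : ℕ) :
    (T - recordTimeNN r₀ X E n ω) * recordProcess r₀ X E (recordTimeNN r₀ X E n ω) ω =
      recordLoad r₀ X E T n ω := by
  rw [recordProcess_eq_recordWeight hr₀ hX hE le_rfl
    (recordTimeNN_strictMono hr₀ hX hE n.lt_succ_self), coe_recordTimeNN hr₀ hX hE, recordLoad]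

/-- The threshold policy does not stop after a record with small load. -/
theorem thresholdPolicy_le (hr₀ : 0 < r₀) (hX : ∀ j, X j ω ∈ Set.Ioo (0 : ℝ) 1)
    (hE : ∀ j, 0 < E j ω) {T : ℝ≥0} {s : ℝ} {n : ℕ}
    (h : recordLoad r₀ X E T (n + 1) ω ≤ s) :
    thresholdPolicy (recordProcess r₀ X E) T s ω ≤ recordTimeNN r₀ X E (n + 1) ω := by
  refine csInf_le' ⟨_, rfl, (isRecordTime_iff hr₀ hX hE).2 ⟨n, rfl⟩, ?_⟩
  rwa [mul_recordProcess_recordTimeNN hr₀ hX hE]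

/-- If the threshold policy stops, it does so at a record with small load. -/
theorem exists_thresholdPolicy_eq (hr₀ : 0 < r₀) (hX : ∀ j, X j ω ∈ Set.Ioo (0 : ℝ) 1)
    (hE : ∀ j, 0 < E j ω) {T : ℝ≥0} {s : ℝ}
    (h : thresholdPolicy (recordProcess r₀ X E) T s ω ≠ ⊤) :
    ∃ n, thresholdPolicy (recordProcess r₀ X E) T s ω = recordTimeNN r₀ X E (n + 1) ω ∧
      recordLoad r₀ X E T (n + 1) ω ≤ s := by
  have hex : ∃ n, recordLoad r₀ X E T (n + 1) ω ≤ s := by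
    by_contra! hno
    refine h ?_
    rw [thresholdPolicy, sInf_eq_top]
    rintro _ ⟨t, rfl, ht, hts⟩
    obtain ⟨n, rfl⟩ := (isRecordTime_iff hr₀ hX hE).1 ht
    rw [mul_recordProcess_recordTimeNN hr₀ hX hE] at hts
    exact absurd hts (not_le.2 (hno n))
  classical
  -- Record times increase, so the infimum is attained at the first index with small load.
  refine ⟨Nat.find hex, le_antisymm (thresholdPolicy_le hr₀ hX hE (Nat.find_spec hex)) ?_,
    Nat.find_spec hex⟩
  refine le_sInf ?_
  rintro _ ⟨t, rfl, ht, hts⟩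
  obtain ⟨n, rfl⟩ := (isRecordTime_iff hr₀ hX hE).1 ht
  rw [mul_recordProcess_recordTimeNN hr₀ hX hE] at hts
  exact_mod_cast (recordTimeNN_strictMono hr₀ hX hE).monotone
    (Nat.succ_le_succ (Nat.find_min' hex hts))

theorem thresholdPolicy_le_iff (hr₀ : 0 < r₀) (hX : ∀ j, X j ω ∈ Set.Ioo (0 : ℝ) 1)
    (hE : ∀ j, 0 < E j ω) {T t : ℝ≥0} {s : ℝ} :
    thresholdPolicy (recordProcess r₀ X E) T s ω ≤ t ↔
      ∃ n, recordTimeNN r₀ X E (n + 1) ω ≤ t ∧ recordLoad r₀ X E T (n + 1) ω ≤ s := by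
  constructor
  · intro h
    obtain ⟨n, hn, hs⟩ := exists_thresholdPolicy_eq hr₀ hX hE
      (h.trans_lt (WithTop.coe_lt_top t)).ne
    exact ⟨n, by rw [hn] at h; exact_mod_cast h, hs⟩
  · rintro ⟨n, hn, hs⟩
    exact (thresholdPolicy_le hr₀ hX hE hs).trans (by exact_mod_cast hn)

/-- The threshold policy has stopped by the `(n+1)`-st record iff that record has small load. -/
theorem exists_thresholdPolicy_eq_iff (hr₀ : 0 < r₀) (hX : ∀ j, X j ω ∈ Set.Ioo (0 : ℝ) 1)
    (hE : ∀ j, 0 < E j ω) {T : ℝ≥0} {s : ℝ} (hs : 0 ≤ s) {n : ℕ} :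
    (∃ m ≤ n, thresholdPolicy (recordProcess r₀ X E) T s ω = recordTimeNN r₀ X E (m + 1) ω) ↔
      recordLoad r₀ X E T (n + 1) ω ≤ s := by
  have hmono := recordTimeNN_strictMono hr₀ hX hE
  constructor
  · rintro ⟨m, hm, h⟩
    obtain ⟨k, hk, hks⟩ := exists_thresholdPolicy_eq hr₀ hX hE (h.trans_ne (WithTop.coe_ne_top))
    have hkm : m + 1 = k + 1 := hmono.injective (by exact_mod_cast h.symm.trans hk)
    exact recordLoad_le_of_le hr₀ hX hE hs (by omega) hks
  · intro h
    have hle := thresholdPolicy_le hr₀ hX hE h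
    obtain ⟨k, hk, -⟩ := exists_thresholdPolicy_eq hr₀ hX hE
      (hle.trans_lt (WithTop.coe_lt_top _)).ne
    refine ⟨k, ?_, hk⟩
    rw [hk] at hle
    have : k + 1 ≤ n + 1 := hmono.le_iff_le.1 (by exact_mod_cast hle)
    omega

end Paths

/-! ### The σ-algebra of the first factors and sojourns. -/

section Past

variable {Ω : Type*} {r₀ : ℝ} {X E : ℕ → Ω → ℝ}

/-- The information in the factors and sojourns with index below `n`. -/
abbrev pastSigma (X E : ℕ → Ω → ℝ) (n : ℕ) : MeasurableSpace Ω :=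
  ⨆ i ∈ {i : ℕ ⊕ ℕ | Sum.elim id id i < n},
    MeasurableSpace.comap (Sum.elim X E i) inferInstance

theorem pastSigma_mono {m n : ℕ} (h : m ≤ n) : pastSigma X E m ≤ pastSigma X E n :=
  biSup_mono fun _ hi => lt_of_lt_of_le hi h

theorem measurable_recordWeight_pastSigma {m n : ℕ} (h : m ≤ n) :
    Measurable[pastSigma X E n] (recordWeight r₀ X m) := by
  refine (Finset.measurable_fun_prod _ fun j hj => ?_).const_mul r₀
  refine measurable_iff_comap_le.2 (le_iSup₂_of_le (Sum.inl j) ?_ le_rfl)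
  exact (Finset.mem_range.1 hj).trans_le h

theorem measurable_recordTime_pastSigma {m n : ℕ} (h : m ≤ n) :
    Measurable[pastSigma X E n] (recordTime r₀ X E m) := by
  refine Finset.measurable_fun_sum _ fun j hj => Measurable.div ?_
    (measurable_recordWeight_pastSigma ((Finset.mem_range.1 hj).le.trans h))
  refine measurable_iff_comap_le.2 (le_iSup₂_of_le (Sum.inr j) ?_ le_rfl)
  exact (Finset.mem_range.1 hj).trans_le h

theorem measurable_recordTimeNN_pastSigma {m n : ℕ} (h : m ≤ n) :
    Measurable[pastSigma X E n] (recordTimeNN r₀ X E m) :=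
  (measurable_recordTime_pastSigma h).real_toNNReal

theorem measurable_recordLoad_pastSigma (T : ℝ) (n : ℕ) :
    Measurable[pastSigma X E n] (recordLoad r₀ X E T n) :=
  ((measurable_recordTime_pastSigma le_rfl).const_sub T).mul
    (measurable_recordWeight_pastSigma le_rfl)

end Past

/-! ### Stopping times of the record filtration. -/

section Filtrations

open TopologicalSpace (denseSeq denseRange_denseSeq)

variable {Ω : Type*} [mΩ : MeasurableSpace Ω] {r₀ : ℝ} {X E : ℕ → Ω → ℝ}

theorem exists_denseSeq_between {a b : ℝ≥0} (h : a < b) :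
    ∃ k, a < denseSeq ℝ≥0 k ∧ denseSeq ℝ≥0 k < b := by
  obtain ⟨_, ⟨k, rfl⟩, hk⟩ := (denseRange_denseSeq ℝ≥0).exists_between h
  exact ⟨k, hk⟩

/-- The natural filtration of the record process, before it is made right-continuous. -/
noncomputable def naturalRecordFiltration (r₀ : ℝ) (hX : ∀ j, Measurable (X j))
    (hE : ∀ j, Measurable (E j)) : Filtration ℝ≥0 mΩ :=
  Filtration.natural (recordProcess r₀ X E)
    fun t => (measurable_recordProcess r₀ hX hE t).stronglyMeasurable

theorem measurableSet_recordFiltration_iff (hX : ∀ j, Measurable (X j))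
    (hE : ∀ j, Measurable (E j)) {t : ℝ≥0} {A : Set Ω} :
    MeasurableSet[recordFiltration r₀ hX hE t] A ↔
      ∀ u > t, MeasurableSet[naturalRecordFiltration r₀ hX hE u] A := by
  rw [recordFiltration, Filtration.rightCont_eq]
  simp only [MeasurableSpace.measurableSet_iInf]
  rfl

theorem measurable_recordProcess_natural (hX : ∀ j, Measurable (X j))
    (hE : ∀ j, Measurable (E j)) {s t : ℝ≥0} (hst : s ≤ t) :
    Measurable[naturalRecordFiltration r₀ hX hE t] (recordProcess r₀ X E s) :=
  measurable_iff_comap_le.2 (le_iSup₂_of_le s hst le_rfl)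

/-- Record times are stopping times. -/
theorem measurableSet_recordTimeNN_le (hX : ∀ j, Measurable (X j)) (hE : ∀ j, Measurable (E j))
    (hX_mem : ∀ j ω, X j ω ∈ Set.Ioo (0 : ℝ) 1) (hE_pos : ∀ j ω, 0 < E j ω) (hr₀ : 0 < r₀)
    (n : ℕ) (t : ℝ≥0) :
    MeasurableSet[naturalRecordFiltration r₀ hX hE t] {ω | recordTimeNN r₀ X E n ω ≤ t} := by
  induction n generalizing t with
  | zero => simp [recordTimeNN_zero]
  | succ n ih =>
    -- The next record has occurred by `t` iff the path drops between some dense time after the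
    -- `n`-th record and `t`.
    have key : {ω | recordTimeNN r₀ X E (n + 1) ω ≤ t} = ⋃ k, ⋃ _ : denseSeq ℝ≥0 k ≤ t,
        {ω | recordTimeNN r₀ X E n ω ≤ denseSeq ℝ≥0 k} ∩
          {ω | recordProcess r₀ X E t ω < recordProcess r₀ X E (denseSeq ℝ≥0 k) ω} := by
      ext ω
      have hX' := fun j => hX_mem j ω
      have hE' := fun j => hE_pos j ω
      simp only [Set.mem_ofPred_eq, Set.mem_iUnion, Set.mem_inter_iff, exists_prop]
      constructor
      · intro h
        obtain ⟨k, hk1, hk2⟩ := exists_denseSeq_between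
          (recordTimeNN_strictMono (E := fun j => E j) hr₀ hX' hE' n.lt_succ_self)
        refine ⟨k, hk2.le.trans h, hk1.le, ?_⟩
        rw [recordProcess_eq_recordWeight hr₀ hX' hE' hk1.le hk2]
        exact (recordProcess_le_of_recordTimeNN_le hr₀ hX' hE' h).trans_lt
          (recordWeight_strictAnti hr₀ hX' n.lt_succ_self)
      · rintro ⟨k, hkt, hk, hlt⟩
        by_contra! hcon
        rw [recordProcess_eq_recordWeight hr₀ hX' hE' hk (hkt.trans_lt hcon),
          recordProcess_eq_recordWeight hr₀ hX' hE' (hk.trans hkt) hcon] at hlt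
        exact lt_irrefl _ hlt
    rw [key]
    refine MeasurableSet.iUnion fun k => MeasurableSet.iUnion fun hk => ?_
    exact ((naturalRecordFiltration r₀ hX hE).mono hk _ (ih _)).inter
      (measurableSet_lt (measurable_recordProcess_natural hX hE le_rfl)
        (measurable_recordProcess_natural hX hE hk))

/-- The record time itself may lie in the future; capped at `t` it is known at `t`. -/
theorem measurable_min_recordTimeNN (hX : ∀ j, Measurable (X j)) (hE : ∀ j, Measurable (E j))
    (hX_mem : ∀ j ω, X j ω ∈ Set.Ioo (0 : ℝ) 1) (hE_pos : ∀ j ω, 0 < E j ω) (hr₀ : 0 < r₀)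
    (n : ℕ) (t : ℝ≥0) :
    Measurable[naturalRecordFiltration r₀ hX hE t] fun ω => min (recordTimeNN r₀ X E n ω) t := by
  refine @measurable_of_Iic _ _ _ _ _ (naturalRecordFiltration r₀ hX hE t) _ _ _ _ fun a => ?_
  rcases le_or_gt t a with h | h
  · convert MeasurableSet.univ using 1
    ext ω
    simp [h]
  · convert (naturalRecordFiltration r₀ hX hE).mono h.le _
      (measurableSet_recordTimeNN_le hX hE hX_mem hE_pos hr₀ n a) using 1
    ext ω
    simp [h]

theorem isStoppingTime_thresholdPolicy (hX : ∀ j, Measurable (X j)) (hE : ∀ j, Measurable (E j))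
    (hX_mem : ∀ j ω, X j ω ∈ Set.Ioo (0 : ℝ) 1) (hE_pos : ∀ j ω, 0 < E j ω) (hr₀ : 0 < r₀)
    (T : ℝ≥0) (s : ℝ) :
    IsStoppingTime (recordFiltration r₀ hX hE) (thresholdPolicy (recordProcess r₀ X E) T s) := by
  intro t
  rw [measurableSet_recordFiltration_iff]
  intro u hu
  have hle := measurableSet_recordTimeNN_le hX hE hX_mem hE_pos hr₀
  have hmono : ∀ {a b : ℝ≥0}, a ≤ b → naturalRecordFiltration r₀ hX hE a ≤
      naturalRecordFiltration r₀ hX hE b := fun h => (naturalRecordFiltration r₀ hX hE).mono h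
  -- The load of a record is read off at a dense time strictly after that record, before the
  -- following one and before `u`. The record may fall exactly at `t`, hence the use of
  -- right-continuity.
  have key : {ω | thresholdPolicy (recordProcess r₀ X E) T s ω ≤ t} = ⋃ n,
      {ω | recordTimeNN r₀ X E (n + 1) ω ≤ t} ∩ ⋃ k, ⋃ _ : denseSeq ℝ≥0 k ≤ u,
        ({ω | recordTimeNN r₀ X E (n + 1) ω ≤ denseSeq ℝ≥0 k} ∩
          {ω | recordTimeNN r₀ X E (n + 2) ω ≤ denseSeq ℝ≥0 k}ᶜ) ∩
          {ω | (T - (min (recordTimeNN r₀ X E (n + 1) ω) (denseSeq ℝ≥0 k) : ℝ≥0)) *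
            recordProcess r₀ X E (denseSeq ℝ≥0 k) ω ≤ s} := by
    ext ω
    have hX' := fun j => hX_mem j ω
    have hE' := fun j => hE_pos j ω
    have hload : ∀ n k, recordTimeNN r₀ X E (n + 1) ω ≤ denseSeq ℝ≥0 k →
        denseSeq ℝ≥0 k < recordTimeNN r₀ X E (n + 2) ω →
        (T - (min (recordTimeNN r₀ X E (n + 1) ω) (denseSeq ℝ≥0 k) : ℝ≥0)) *
            recordProcess r₀ X E (denseSeq ℝ≥0 k) ω = recordLoad r₀ X E T (n + 1) ω := by
      intro n k h1 h2
      rw [min_eq_left h1, recordProcess_eq_recordWeight hr₀ hX' hE' h1 h2,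
        coe_recordTimeNN hr₀ hX' hE', recordLoad]
    simp only [Set.mem_ofPred_eq, thresholdPolicy_le_iff hr₀ hX' hE', Set.mem_iUnion,
      Set.mem_inter_iff, exists_prop, Set.mem_compl_iff, not_le]
    refine exists_congr fun n => and_congr_right fun hn => ?_
    constructor
    · intro h
      obtain ⟨k, hk1, hk2⟩ := exists_denseSeq_between (lt_min (hn.trans_lt hu)
        (recordTimeNN_strictMono (E := fun j => E j) hr₀ hX' hE' (n + 1).lt_succ_self))
      have hk3 := hk2.trans_le (min_le_right _ _)
      exact ⟨k, (hk2.trans_le (min_le_left _ _)).le, ⟨hk1.le, hk3⟩,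
        (hload n k hk1.le hk3).trans_le h⟩
    · rintro ⟨k, -, ⟨hk1, hk2⟩, h⟩
      rwa [hload n k hk1 hk2] at h
  rw [key]
  refine MeasurableSet.iUnion fun n => (hmono hu.le _ (hle _ _)).inter
    (MeasurableSet.iUnion fun k => MeasurableSet.iUnion fun hk => ?_)
  refine ((hmono hk _ (hle _ _)).inter (hmono hk _ (hle _ _).compl)).inter ?_
  refine hmono hk _ (measurableSet_le ?_ measurable_const)
  exact ((measurable_coe_nnreal_real.comp
    (measurable_min_recordTimeNN hX hE hX_mem hE_pos hr₀ _ _)).const_sub _).mul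
      (measurable_recordProcess_natural hX hE le_rfl)

theorem pastSigma_le (hX : ∀ j, Measurable (X j)) (hE : ∀ j, Measurable (E j)) (n : ℕ) :
    pastSigma X E n ≤ mΩ := by
  refine iSup₂_le fun i _ => ?_
  rcases i with i | i
  exacts [(hX i).comap_le, (hE i).comap_le]

/-- Before the `(n+1)`-st record, the natural filtration of the record process carries no
information beyond the first `n` factors and sojourns. -/
theorem exists_pastSigma_trace (hX : ∀ j, Measurable (X j)) (hE : ∀ j, Measurable (E j))
    (hX_mem : ∀ j ω, X j ω ∈ Set.Ioo (0 : ℝ) 1) (hE_pos : ∀ j ω, 0 < E j ω) (hr₀ : 0 < r₀)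
    {u : ℝ≥0} {A : Set Ω} (hA : MeasurableSet[naturalRecordFiltration r₀ hX hE u] A) (n : ℕ) :
    ∃ B, MeasurableSet[pastSigma X E n] B ∧
      ∀ ω, u < recordTimeNN r₀ X E (n + 1) ω → (ω ∈ A ↔ ω ∈ B) := by
  set S : Set Ω := {ω | u < recordTimeNN r₀ X E (n + 1) ω}
  have hle : MeasurableSpace.comap ((↑) : S → Ω) (naturalRecordFiltration r₀ hX hE u) ≤
      MeasurableSpace.comap ((↑) : S → Ω) (pastSigma X E n) := by
    have hnat : (naturalRecordFiltration r₀ hX hE u : MeasurableSpace Ω) =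
        ⨆ t ≤ u, MeasurableSpace.comap (recordProcess r₀ X E t) inferInstance := rfl
    rw [hnat]
    rw [MeasurableSpace.comap_iSup]
    refine iSup_le fun t => ?_
    rw [MeasurableSpace.comap_iSup]
    refine iSup_le fun ht => ?_
    rw [MeasurableSpace.comap_comp]
    -- On `S` the records beyond the `n`-th come after `t`, so finitely many terms of the infimum
    -- suffice.
    set R : Ω → ℝ := fun ω => ⨅ k : Fin (n + 1),
      if recordTime r₀ X E k ω ≤ t then recordWeight r₀ X k ω else r₀
    have hR : Measurable[pastSigma X E n] R := by
      refine Measurable.iInf fun k => ?_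
      have hk : (k : ℕ) ≤ n := Nat.lt_succ_iff.1 k.2
      exact Measurable.ite (measurableSet_le (measurable_recordTime_pastSigma hk)
        measurable_const) (measurable_recordWeight_pastSigma hk) measurable_const
    have heq : recordProcess r₀ X E t ∘ ((↑) : S → Ω) = R ∘ ((↑) : S → Ω) := by
      funext ⟨ω, hω⟩
      have hX' := fun j => hX_mem j ω
      have hE' := fun j => hE_pos j ω
      have hbdd := bddBelow_recordProcess (E := E) hr₀ hX' t
      refine le_antisymm (le_ciInf fun k => ciInf_le hbdd (k : ℕ)) (le_ciInf fun k => ?_)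
      have hfin := fun k : Fin (n + 1) => ciInf_le (Set.finite_range fun k : Fin (n + 1) =>
        if recordTime r₀ X E k ω ≤ t then recordWeight r₀ X k ω else r₀).bddBelow k
      rcases lt_or_ge k (n + 1) with hk | hk
      · exact hfin ⟨k, hk⟩
      · have hlt : ¬ recordTime r₀ X E k ω ≤ t := by
          rw [← coe_recordTimeNN hr₀ hX' hE', NNReal.coe_le_coe, not_le]
          exact (ht.trans_lt hω).trans_le
            ((recordTimeNN_strictMono hr₀ hX' hE').monotone hk)
        rw [if_neg hlt]
        -- The discarded terms equal `r₀`, which the term of index `0` equals in either branch.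
        refine (hfin 0).trans ?_
        simp [recordWeight_zero]
    rw [heq, ← MeasurableSpace.comap_comp]
    exact MeasurableSpace.comap_mono hR.comap_le
  obtain ⟨B, hB, hBA⟩ := hle _ ⟨A, hA, rfl⟩
  refine ⟨B, hB, fun ω hω => ?_⟩
  have := Set.ext_iff.1 hBA ⟨ω, hω⟩
  exact this.symm

theorem measurableSet_lt_of_isStoppingTime (hX : ∀ j, Measurable (X j))
    (hE : ∀ j, Measurable (E j)) {π : Ω → WithTop ℝ≥0}
    (hπ : IsStoppingTime (recordFiltration r₀ hX hE) π) (q : ℝ≥0) :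
    MeasurableSet[naturalRecordFiltration r₀ hX hE q] {ω | π ω < q} := by
  have key : {ω | π ω < q} = ⋃ k, ⋃ _ : denseSeq ℝ≥0 k < q,
      {ω | π ω ≤ (denseSeq ℝ≥0 k : ℝ≥0)} := by
    ext ω
    simp only [Set.mem_ofPred_eq, Set.mem_iUnion, exists_prop]
    constructor
    · intro h
      obtain ⟨p, hp⟩ := WithTop.ne_top_iff_exists.1 (h.trans (WithTop.coe_lt_top q)).ne
      rw [← hp] at h ⊢
      obtain ⟨k, hk1, hk2⟩ := exists_denseSeq_between (WithTop.coe_lt_coe.1 h)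
      exact ⟨k, hk2, WithTop.coe_le_coe.2 hk1.le⟩
    · rintro ⟨k, hk, h⟩
      exact h.trans_lt (WithTop.coe_lt_coe.2 hk)
  rw [key]
  exact MeasurableSet.iUnion fun k => MeasurableSet.iUnion fun hk =>
    (measurableSet_recordFiltration_iff hX hE).1 (hπ _) q hk

/-- Whether a policy stops at the `(n+1)`-st record is determined by the factors and sojourns up
to that record. -/
theorem measurableSet_eq_recordTimeNN (hX : ∀ j, Measurable (X j)) (hE : ∀ j, Measurable (E j))
    (hX_mem : ∀ j ω, X j ω ∈ Set.Ioo (0 : ℝ) 1) (hE_pos : ∀ j ω, 0 < E j ω) (hr₀ : 0 < r₀)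
    {π : Ω → WithTop ℝ≥0} (hπ : IsStoppingTime (recordFiltration r₀ hX hE) π) (n : ℕ) :
    MeasurableSet[pastSigma X E (n + 1)] {ω | π ω = recordTimeNN r₀ X E (n + 1) ω} := by
  choose B hB hπB using fun m k => exists_pastSigma_trace hX hE hX_mem hE_pos hr₀
    (measurableSet_lt_of_isStoppingTime hX hE hπ (denseSeq ℝ≥0 k)) m
  have hT := measurable_recordTimeNN_pastSigma (r₀ := r₀) (X := X) (E := E) (le_refl (n + 1))
  -- A dense time between `π` and the record detects the strict inequality; before that record only
  -- the first `n` pairs are visible.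
  have h1 : {ω | π ω < recordTimeNN r₀ X E (n + 1) ω} =
      ⋃ k, {ω | denseSeq ℝ≥0 k < recordTimeNN r₀ X E (n + 1) ω} ∩ B n k := by
    ext ω
    simp only [Set.mem_ofPred_eq, Set.mem_iUnion, Set.mem_inter_iff]
    constructor
    · intro h
      obtain ⟨p, hp⟩ := WithTop.ne_top_iff_exists.1 (h.trans (WithTop.coe_lt_top _)).ne
      rw [← hp] at h
      obtain ⟨k, hk1, hk2⟩ := exists_denseSeq_between (WithTop.coe_lt_coe.1 h)
      refine ⟨k, hk2, (hπB n k ω hk2).1 ?_⟩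
      rw [Set.mem_ofPred_eq, ← hp]
      exact WithTop.coe_lt_coe.2 hk1
    · rintro ⟨k, hk, h⟩
      have h' : π ω < denseSeq ℝ≥0 k := (hπB n k ω hk).2 h
      exact h'.trans (WithTop.coe_lt_coe.2 hk)
  -- Here `π` has to be below all dense times just after the record, where the path still shows only
  -- `n + 1` pairs. The next record time is not measurable for this past, so an existential dense
  -- time `k` replaces it as upper limit.
  have h2 : {ω | π ω ≤ recordTimeNN r₀ X E (n + 1) ω} =
      ⋃ k, {ω | recordTimeNN r₀ X E (n + 1) ω < denseSeq ℝ≥0 k} ∩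
        ⋂ j, ({ω | recordTimeNN r₀ X E (n + 1) ω < denseSeq ℝ≥0 j}ᶜ ∪
          ({_ω | denseSeq ℝ≥0 j < denseSeq ℝ≥0 k}ᶜ ∪ B (n + 1) j)) := by
    ext ω
    have hlt := recordTimeNN_strictMono (E := fun j => E j) hr₀ (fun j => hX_mem j ω)
      (fun j => hE_pos j ω) (n + 1).lt_succ_self
    simp only [Set.mem_ofPred_eq, Set.mem_iUnion, Set.mem_inter_iff, Set.mem_iInter,
      Set.mem_union, Set.mem_compl_iff, ← imp_iff_not_or]
    constructor
    · intro h
      obtain ⟨k, hk1, hk2⟩ := exists_denseSeq_between hlt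
      refine ⟨k, hk1, fun j hj hjk => (hπB (n + 1) j ω (hjk.trans hk2)).1 ?_⟩
      exact h.trans_lt (WithTop.coe_lt_coe.2 hj)
    · rintro ⟨k, hk, h⟩
      by_contra! hcon
      have : ∃ q, recordTimeNN r₀ X E (n + 1) ω < q ∧ (q : WithTop ℝ≥0) ≤ π ω := by
        rcases eq_or_ne (π ω) ⊤ with ht | ht
        · exact ⟨_, hk, ht ▸ le_top⟩
        · obtain ⟨p, hp⟩ := WithTop.ne_top_iff_exists.1 ht
          rw [← hp] at hcon ⊢
          exact ⟨p, WithTop.coe_lt_coe.1 hcon, le_rfl⟩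
      obtain ⟨q, hq, hqπ⟩ := this
      obtain ⟨j, hj1, hj2⟩ := exists_denseSeq_between (lt_min hq (lt_min hk hlt))
      have hjq := hj2.trans_le (min_le_left _ _)
      have hj3 := hj2.trans_le (min_le_right _ _)
      have h' : π ω < denseSeq ℝ≥0 j := (hπB (n + 1) j ω (hj3.trans_le (min_le_right _ _))).2
        (h j hj1 (hj3.trans_le (min_le_left _ _)))
      exact absurd (h'.trans (WithTop.coe_lt_coe.2 hjq)) (not_lt.2 hqπ)
  have h3 : {ω | π ω = recordTimeNN r₀ X E (n + 1) ω} =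
      {ω | π ω ≤ recordTimeNN r₀ X E (n + 1) ω} \
        {ω | π ω < recordTimeNN r₀ X E (n + 1) ω} := by
    ext ω
    exact ⟨fun h => ⟨h.le, h.not_lt⟩, fun h => le_antisymm h.1 (not_lt.1 h.2)⟩
  rw [h3, h1, h2]
  refine MeasurableSet.diff (MeasurableSet.iUnion fun k => ?_) (MeasurableSet.iUnion fun k => ?_)
  · refine (measurableSet_lt hT measurable_const).inter (MeasurableSet.iInter fun j => ?_)
    exact (measurableSet_lt hT measurable_const).compl.union
      ((MeasurableSet.const _).compl.union (hB _ _))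
  · exact (measurableSet_lt measurable_const hT).inter (pastSigma_mono n.le_succ _ (hB _ _))

end Filtrations

/-! ### The critical equation and the one-step expectations. -/

section Analysis

/-- Factor out e^{s(1-x)} ≥ 1 and use e^z ≥ 1 + z: the quotient grows at rate at least 1. The
alternative `t < s` stands in for a hypothesis `s ≤ t`. -/
theorem sub_le_exp_quotient_sub {s t x : ℝ} (hs : 0 ≤ s) (hx : x < 1) :
    t - s ≤ (Real.exp (t * (1 - x)) - 1) / (1 - x) - (Real.exp (s * (1 - x)) - 1) / (1 - x) ∨
      t < s := by
  rcases lt_or_ge t s with h | h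
  · exact Or.inr h
  left
  have hu : 0 < 1 - x := by linarith
  rw [← sub_div, le_div_iff₀ hu]
  have h1 : Real.exp (t * (1 - x)) = Real.exp (s * (1 - x)) * Real.exp ((t - s) * (1 - x)) := by
    rw [← Real.exp_add]
    ring_nf
  have h2 := Real.add_one_le_exp ((t - s) * (1 - x))
  have h3 : 1 ≤ Real.exp (s * (1 - x)) := Real.one_le_exp (mul_nonneg hs hu.le)
  have h4 : 0 ≤ (t - s) * (1 - x) := mul_nonneg (by linarith) hu.le
  nlinarith

theorem exp_quotient_nonneg {s x : ℝ} (hs : 0 ≤ s) (hx : x < 1) :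
    0 ≤ (Real.exp (s * (1 - x)) - 1) / (1 - x) :=
  div_nonneg (sub_nonneg.2 (Real.one_le_exp (mul_nonneg hs (by linarith)))) (by linarith)

/-- From e^z - 1 ≤ z e^z at z = s(1 - x). The bound is uniform in `x`, although the denominator
vanishes as `x` tends to 1, and serves for domination. -/
theorem exp_quotient_le {s M x : ℝ} (hs : 0 ≤ s) (hsM : s ≤ M) (hx : x ∈ Set.Ioo (0 : ℝ) 1) :
    (Real.exp (s * (1 - x)) - 1) / (1 - x) ≤ M * Real.exp M := by
  have hu : 0 < 1 - x := by linarith [hx.2]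
  have h1 : Real.exp (s * (1 - x)) - 1 ≤ s * (1 - x) * Real.exp (s * (1 - x)) := by
    have h2 := Real.add_one_le_exp (-(s * (1 - x)))
    have h3 : Real.exp (-(s * (1 - x))) * Real.exp (s * (1 - x)) = 1 := by
      rw [← Real.exp_add]
      simp
    nlinarith [Real.exp_pos (s * (1 - x))]
  have h4 : Real.exp (s * (1 - x)) ≤ Real.exp M :=
    Real.exp_le_exp.2 ((mul_le_of_le_one_right hs (by linarith [hx.1])).trans hsM)
  have hM : 0 ≤ M * (1 - x) := mul_nonneg (hs.trans hsM) hu.le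
  rw [div_le_iff₀ hu]
  calc _ ≤ _ := h1
    _ ≤ M * (1 - x) * Real.exp M := by gcongr
    _ = _ := by ring

theorem measurable_exp_quotient (s : ℝ) :
    Measurable fun x : ℝ => (Real.exp (s * (1 - x)) - 1) / (1 - x) := by
  fun_prop

variable {ν : Measure ℝ} [IsProbabilityMeasure ν]

theorem integrable_exp_quotient (hν : ∀ᵐ x ∂ν, x ∈ Set.Ioo (0 : ℝ) 1) {s : ℝ} (hs : 0 ≤ s) :
    Integrable (fun x => (Real.exp (s * (1 - x)) - 1) / (1 - x)) ν := by
  refine Integrable.of_bound (measurable_exp_quotient s).aestronglyMeasurable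
    (s * Real.exp s) ?_
  filter_upwards [hν] with x hx
  rw [Real.norm_of_nonneg (exp_quotient_nonneg hs hx.2)]
  exact exp_quotient_le hs le_rfl hx

theorem sub_le_integral_exp_quotient_sub (hν : ∀ᵐ x ∂ν, x ∈ Set.Ioo (0 : ℝ) 1) {s t : ℝ}
    (hs : 0 ≤ s) (hst : s ≤ t) :
    t - s ≤ ∫ x, (Real.exp (t * (1 - x)) - 1) / (1 - x) ∂ν -
      ∫ x, (Real.exp (s * (1 - x)) - 1) / (1 - x) ∂ν := by
  have hi := integrable_exp_quotient hν hs
  have hi' := integrable_exp_quotient hν (hs.trans hst)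
  rw [← integral_sub hi' hi]
  have := integral_mono_ae (μ := ν) (integrable_const (t - s)) (hi'.sub hi) (by
    filter_upwards [hν] with x hx
    exact (sub_le_exp_quotient_sub hs hx.2).resolve_right (not_lt.2 hst))
  simpa using this

/-- Growth at rate at least 1 from the value 0 at 0 puts the value at 1 above 1, so the intermediate
value theorem on [0, 1] applies. The same growth gives uniqueness. -/
theorem existsUnique_integral_exp_quotient_eq_one (hν : ∀ᵐ x ∂ν, x ∈ Set.Ioo (0 : ℝ) 1) :
    ∃! s : ℝ, 0 < s ∧ ∫ x, (Real.exp (s * (1 - x)) - 1) / (1 - x) ∂ν = 1 := by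
  have hcont : ContinuousOn (fun s : ℝ => ∫ x, (Real.exp (s * (1 - x)) - 1) / (1 - x) ∂ν)
      (Set.Icc 0 1) := by
    refine continuousOn_of_dominated (bound := fun _ => 1 * Real.exp 1)
      (fun s _ => (measurable_exp_quotient s).aestronglyMeasurable) (fun s hs => ?_)
      (integrable_const _) (ae_of_all _ fun x => by fun_prop)
    filter_upwards [hν] with x hx
    rw [Real.norm_of_nonneg (exp_quotient_nonneg hs.1 hx.2)]
    exact exp_quotient_le hs.1 hs.2 hx
  have h0 : ∫ x, (Real.exp (0 * (1 - x)) - 1) / (1 - x) ∂ν = 0 := by simp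
  have h1 := sub_le_integral_exp_quotient_sub hν le_rfl zero_le_one
  rw [h0] at h1
  obtain ⟨s, hs, hs1⟩ := intermediate_value_Icc zero_le_one hcont
    (show (1 : ℝ) ∈ _ from ⟨by rw [h0]; exact zero_le_one, by linarith⟩)
  have hpos : 0 < s := by
    refine lt_of_le_of_ne hs.1 fun h => ?_
    subst h
    simp at hs1
  refine ⟨s, ⟨hpos, hs1⟩, fun t ⟨ht, ht1⟩ => ?_⟩
  simp only at hs1
  rcases le_total s t with h | h
  · have := sub_le_integral_exp_quotient_sub hν hpos.le h
    linarith
  · have := sub_le_integral_exp_quotient_sub hν ht.le h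
    linarith

/-- The probability that no record follows when the load is `y`, and `0` after the horizon. -/
noncomputable def stopGain (y : ℝ) : ℝ := if 0 < y then Real.exp (-y) else 0

theorem stopGain_of_pos {y : ℝ} (hy : 0 < y) : stopGain y = Real.exp (-y) := if_pos hy

theorem stopGain_of_nonpos {y : ℝ} (hy : y ≤ 0) : stopGain y = 0 := if_neg (not_lt.2 hy)

theorem stopGain_nonneg (y : ℝ) : 0 ≤ stopGain y := by
  unfold stopGain
  split_ifs
  exacts [(Real.exp_pos _).le, le_rfl]

theorem stopGain_le_one (y : ℝ) : stopGain y ≤ 1 := by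
  unfold stopGain
  split_ifs with h
  exacts [Real.exp_le_one_iff.2 (by linarith), zero_le_one]

theorem measurable_stopGain : Measurable stopGain :=
  Measurable.ite measurableSet_Ioi (by fun_prop) measurable_const

theorem integral_expMeasure_one (φ : ℝ → ℝ) :
    ∫ e, φ e ∂(expMeasure 1) = ∫ e in Set.Ici 0, Real.exp (-e) * φ e := by
  have h : expMeasure 1 = volume.withDensity (exponentialPDF 1) := rfl
  have hm : Measurable (exponentialPDF 1) := (measurable_exponentialPDFReal 1).ennreal_ofReal
  rw [h, integral_withDensity_eq_integral_toReal_smul hm (ae_of_all _ fun _ => ENNReal.ofReal_lt_top),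
    ← integral_indicator measurableSet_Ici]
  refine integral_congr_ae (ae_of_all _ fun e => ?_)
  simp only [exponentialPDF_eq, Set.indicator, Set.mem_Ici]
  split_ifs
  · rw [ENNReal.toReal_ofReal (by positivity)]
    simp
  · simp

/-- The expected gain of stopping at the next record, given the factor `x` of that record. -/
theorem integral_stopGain_sub_mul {y x : ℝ} (hx : x ∈ Set.Ioo (0 : ℝ) 1) :
    ∫ e, stopGain ((y - e) * x) ∂(expMeasure 1) =
      stopGain y * ((Real.exp (y * (1 - x)) - 1) / (1 - x)) := by
  rw [integral_expMeasure_one]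
  rcases le_or_gt y 0 with hy | hy
  · rw [stopGain_of_nonpos hy, zero_mul]
    refine setIntegral_eq_zero_of_forall_eq_zero fun e he => ?_
    have he' : 0 ≤ e := he
    rw [stopGain_of_nonpos (mul_nonpos_of_nonpos_of_nonneg (by linarith) hx.1.le), mul_zero]
  · have hu : 1 - x ≠ 0 := by linarith [hx.2]
    -- The gain survives only for e < y, and -e - (y - e)x = -yx - (1 - x)e.
    have h1 : ∫ e in Set.Ici 0, Real.exp (-e) * stopGain ((y - e) * x) =
        ∫ e in Set.Ico 0 y, Real.exp (-(y * x)) * Real.exp (-(1 - x) * e) := by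
      rw [← integral_indicator measurableSet_Ici, ← integral_indicator measurableSet_Ico]
      refine integral_congr_ae (ae_of_all _ fun e => ?_)
      simp only [Set.indicator, Set.mem_Ici, Set.mem_Ico]
      by_cases h0 : 0 ≤ e
      · by_cases h2 : e < y
        · rw [if_pos h0, if_pos ⟨h0, h2⟩, stopGain_of_pos (mul_pos (by linarith) hx.1),
            ← Real.exp_add, ← Real.exp_add]
          ring_nf
        · rw [if_pos h0, if_neg fun h => h2 h.2, stopGain_of_nonpos
            (mul_nonpos_of_nonpos_of_nonneg (by linarith) hx.1.le), mul_zero]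
      · rw [if_neg h0, if_neg fun h => h0 h.1]
    rw [h1, integral_Ico_eq_integral_Ioc, ← intervalIntegral.integral_of_le hy.le,
      intervalIntegral.integral_const_mul,
      intervalIntegral.integral_comp_mul_left (fun z => Real.exp z) (neg_ne_zero.2 hu),
      integral_exp, stopGain_of_pos hy]
    have h2 : Real.exp (y * (1 - x)) = Real.exp y * Real.exp (-(y * x)) := by
      rw [← Real.exp_add]
      ring_nf
    have h3 : Real.exp (-(1 - x) * y) = Real.exp (-y) * Real.exp (y * x) := by
      rw [← Real.exp_add]
      ring_nf
    have h4 : Real.exp (-(y * x)) * Real.exp (y * x) = 1 := by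
      rw [← Real.exp_add]
      simp
    have h5 : Real.exp (-y) * Real.exp y = 1 := by
      rw [← Real.exp_add]
      simp
    rw [h2, h3, mul_zero, Real.exp_zero, smul_eq_mul, inv_neg]
    field_simp
    linear_combination -Real.exp (-y) * h4 - Real.exp (-(y * x)) * h5

/-- One step multiplies the expected gain by the left side of the critical equation, evaluated at
the current load. -/
theorem integral_stopGain_prod (hν : ∀ᵐ x ∂ν, x ∈ Set.Ioo (0 : ℝ) 1) (y : ℝ) :
    ∫ w : ℝ × ℝ, stopGain ((y - w.1) * w.2) ∂((expMeasure 1).prod ν) =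
      stopGain y * ∫ x, (Real.exp (y * (1 - x)) - 1) / (1 - x) ∂ν := by
  have := isProbabilityMeasure_expMeasure one_pos
  rw [integral_prod_symm, ← integral_const_mul]
  · refine integral_congr_ae ?_
    filter_upwards [hν] with x hx
    exact integral_stopGain_sub_mul hx
  · refine Integrable.of_bound
      (measurable_stopGain.comp (by fun_prop)).aestronglyMeasurable 1 (ae_of_all _ fun w => ?_)
    rw [Real.norm_of_nonneg (stopGain_nonneg _)]
    exact stopGain_le_one _

theorem expMeasure_one_real_Ioi {y : ℝ} (hy : 0 ≤ y) :
    (expMeasure 1).real (Set.Ioi y) = Real.exp (-y) := by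
  have := isProbabilityMeasure_expMeasure one_pos
  have h := cdf_expMeasure_eq one_pos y
  rw [if_pos hy, cdf_eq_real] at h
  rw [← Set.compl_Iic, probReal_compl_eq_one_sub measurableSet_Iic, h]
  simp

/-- This is the exponential tail. The idle factor is kept so that the pair is integrated out by the
same independence lemma. -/
theorem integral_indicator_lt_expMeasure (y : ℝ) :
    ∫ w : ℝ × ℝ, (if 0 < y ∧ y < w.1 then (1 : ℝ) else 0) ∂((expMeasure 1).prod ν) =
      stopGain y := by
  have := isProbabilityMeasure_expMeasure one_pos
  rcases le_or_gt y 0 with hy | hy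
  · simp [not_lt.2 hy, stopGain_of_nonpos hy]
  · have h : (fun w : ℝ × ℝ => if 0 < y ∧ y < w.1 then (1 : ℝ) else 0) =
        (Set.Ioi y ×ˢ Set.univ).indicator 1 := by
      funext w
      simp [Set.indicator, hy]
    rw [h, integral_indicator_one (measurableSet_Ioi.prod MeasurableSet.univ),
      measureReal_prod_prod, expMeasure_one_real_Ioi hy.le, stopGain_of_pos hy]
    simp

end Analysis

/-! ### Gains of policies forced to stop. -/

section Gains

variable {Ω : Type*} {r₀ : ℝ} {X E : ℕ → Ω → ℝ}

/-- `1` if the policy stops at the `(n+1)`-st record, else `0`. -/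
noncomputable def stopsAt (r₀ : ℝ) (X E : ℕ → Ω → ℝ) (π : Ω → WithTop ℝ≥0) (n : ℕ) : Ω → ℝ :=
  Set.indicator {ω | π ω = recordTimeNN r₀ X E (n + 1) ω} fun _ => 1

/-- `1` if the policy stops at none of the first `n + 1` records, else `0`. -/
noncomputable def passes (r₀ : ℝ) (X E : ℕ → Ω → ℝ) (π : Ω → WithTop ℝ≥0) (n : ℕ) (ω : Ω) : ℝ :=
  1 - ∑ m ∈ Finset.range (n + 1), stopsAt r₀ X E π m ω

/-- The gain of a policy that is forced to stop at the `(n+1)`-st record at the latest. -/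
noncomputable def truncatedGain (r₀ : ℝ) (X E : ℕ → Ω → ℝ) (T : ℝ) (π : Ω → WithTop ℝ≥0) (n : ℕ)
    (ω : Ω) : ℝ :=
  ∑ m ∈ Finset.range (n + 1), stopsAt r₀ X E π m ω * stopGain (recordLoad r₀ X E T (m + 1) ω) +
    passes r₀ X E π n ω * stopGain (recordLoad r₀ X E T (n + 1) ω)

theorem truncatedGain_zero (T : ℝ) (π : Ω → WithTop ℝ≥0) (ω : Ω) :
    truncatedGain r₀ X E T π 0 ω = stopGain (recordLoad r₀ X E T 1 ω) := by
  simp [truncatedGain, passes]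
  ring

/-- Delaying the forced stop matters only on paths that have passed all the first `n + 1` records.
-/
theorem truncatedGain_succ (T : ℝ) (π : Ω → WithTop ℝ≥0) (n : ℕ) (ω : Ω) :
    truncatedGain r₀ X E T π (n + 1) ω = truncatedGain r₀ X E T π n ω + passes r₀ X E π n ω *
      (stopGain (recordLoad r₀ X E T (n + 2) ω) - stopGain (recordLoad r₀ X E T (n + 1) ω)) := by
  simp only [truncatedGain, passes, Finset.sum_range_succ _ (n + 1)]
  ring

theorem stopsAt_of_eq {π : Ω → WithTop ℝ≥0} {n : ℕ} {ω : Ω}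
    (h : π ω = recordTimeNN r₀ X E (n + 1) ω) : stopsAt r₀ X E π n ω = 1 :=
  Set.indicator_of_mem (show ω ∈ {ω | π ω = recordTimeNN r₀ X E (n + 1) ω} from h) _

theorem stopsAt_of_ne {π : Ω → WithTop ℝ≥0} {n : ℕ} {ω : Ω}
    (h : π ω ≠ recordTimeNN r₀ X E (n + 1) ω) : stopsAt r₀ X E π n ω = 0 :=
  Set.indicator_of_notMem (show ω ∉ {ω | π ω = recordTimeNN r₀ X E (n + 1) ω} from h) _

theorem stopsAt_nonneg (π : Ω → WithTop ℝ≥0) (n : ℕ) (ω : Ω) : 0 ≤ stopsAt r₀ X E π n ω :=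
  Set.indicator_nonneg (fun _ _ => zero_le_one) ω

theorem stopsAt_le_one (π : Ω → WithTop ℝ≥0) (n : ℕ) (ω : Ω) : stopsAt r₀ X E π n ω ≤ 1 :=
  Set.indicator_le_self' (fun _ _ => zero_le_one) ω

open scoped Classical in
theorem passes_eq (hX_mem : ∀ j ω, X j ω ∈ Set.Ioo (0 : ℝ) 1) (hE_pos : ∀ j ω, 0 < E j ω)
    (hr₀ : 0 < r₀) (π : Ω → WithTop ℝ≥0) (n : ℕ) (ω : Ω) :
    passes r₀ X E π n ω = if ∃ m ≤ n, π ω = recordTimeNN r₀ X E (m + 1) ω then 0 else 1 := by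
  have hmono := recordTimeNN_strictMono hr₀ (fun j => hX_mem j ω) (fun j => hE_pos j ω)
  rw [passes]
  split_ifs with h
  · obtain ⟨m, hm, hπ⟩ := h
    rw [Finset.sum_eq_single_of_mem m (Finset.mem_range.2 (Nat.lt_succ_iff.2 hm))]
    · rw [stopsAt_of_eq hπ, sub_self]
    · intro k _ hkm
      refine stopsAt_of_ne fun hk => hkm ?_
      have : k + 1 = m + 1 := hmono.injective (WithTop.coe_injective (hk.symm.trans hπ))
      omega
  · rw [Finset.sum_eq_zero, sub_zero]
    intro m hm
    exact stopsAt_of_ne fun hπ => h ⟨m, Nat.lt_succ_iff.1 (Finset.mem_range.1 hm), hπ⟩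

theorem passes_mem_Icc (hX_mem : ∀ j ω, X j ω ∈ Set.Ioo (0 : ℝ) 1) (hE_pos : ∀ j ω, 0 < E j ω)
    (hr₀ : 0 < r₀) (π : Ω → WithTop ℝ≥0) (n : ℕ) (ω : Ω) :
    passes r₀ X E π n ω ∈ Set.Icc (0 : ℝ) 1 := by
  classical
  rw [passes_eq hX_mem hE_pos hr₀]
  split_ifs <;> simp

/-- By absorption of small loads, the current load alone decides whether the policy has stopped;
this makes it a pointwise maximiser. -/
theorem passes_thresholdPolicy (hX_mem : ∀ j ω, X j ω ∈ Set.Ioo (0 : ℝ) 1)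
    (hE_pos : ∀ j ω, 0 < E j ω) (hr₀ : 0 < r₀) (T : ℝ≥0) {s : ℝ} (hs : 0 ≤ s) (n : ℕ) (ω : Ω) :
    passes r₀ X E (thresholdPolicy (recordProcess r₀ X E) T s) n ω =
      if recordLoad r₀ X E T (n + 1) ω ≤ s then 0 else 1 := by
  classical
  rw [passes_eq hX_mem hE_pos hr₀]
  exact if_congr (exists_thresholdPolicy_eq_iff hr₀ (fun j => hX_mem j ω)
    (fun j => hE_pos j ω) hs) rfl rfl

/-- All earlier loads were positive too, so each sojourn is below its load, which is at most the
initial load `T * r₀`. -/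
theorem sojourn_le_of_recordLoad_pos (hX_mem : ∀ j ω, X j ω ∈ Set.Ioo (0 : ℝ) 1)
    (hE_pos : ∀ j ω, 0 < E j ω) (hr₀ : 0 < r₀) (T : ℝ≥0) (n : ℕ) (ω : Ω)
    (h : 0 < recordLoad r₀ X E T n ω) {j : ℕ} (hj : j < n) : E j ω ≤ T * r₀ := by
  have hX' := fun j => hX_mem j ω
  have hE' := fun j => hE_pos j ω
  have h1 : 0 < recordLoad r₀ X E T (j + 1) ω := by
    by_contra! hcon
    exact absurd (recordLoad_le_of_le hr₀ hX' hE' le_rfl hj hcon) (not_le.2 h)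
  have h2 : recordLoad r₀ X E T j ω ≤ T * r₀ :=
    recordLoad_le_of_le hr₀ hX' hE' (mul_nonneg T.2 hr₀.le) j.zero_le (recordLoad_zero _).le
  rw [recordLoad_succ hr₀ hX'] at h1
  have h3 := (mul_pos_iff_of_pos_right (hX' j).1).1 h1
  linarith

end Gains

/-! ### Independence of past and next step. -/

section Probability

/-- Integrating out a variable `W` that is independent of a σ-algebra. -/
theorem integral_mul_comp_of_indep {Ω β : Type*} [MeasurableSpace β] {m mΩ : MeasurableSpace Ω}
    {P : Measure Ω} [IsProbabilityMeasure P]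
    (hm : m ≤ mΩ) {W : Ω → β} (hW : Measurable W)
    (hind : Indep m (MeasurableSpace.comap W inferInstance) P) {h Y : Ω → ℝ}
    (hh : Measurable[m] h) (hY : Measurable[m] Y) {C : ℝ} (hC : ∀ ω, |h ω| ≤ C)
    {F : ℝ × β → ℝ} (hF : Measurable F) {D : ℝ} (hD : ∀ z, |F z| ≤ D) :
    ∫ ω, h ω * F (Y ω, W ω) ∂P = ∫ ω, h ω * ∫ w, F (Y ω, w) ∂(P.map W) ∂P := by
  have hhY : Measurable[m] fun ω => (h ω, Y ω) := hh.prodMk hY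
  have hhY' : Measurable fun ω => (h ω, Y ω) := hhY.mono hm le_rfl
  have hindF : IndepFun (fun ω => (h ω, Y ω)) W P := by
    rw [IndepFun_iff_Indep]
    exact indep_of_indep_of_le_left hind hhY.comap_le
  have hmap := hindF.map_prod_eq_prod_map_map hhY'.aemeasurable hW.aemeasurable
  have : IsProbabilityMeasure (P.map W) := Measure.isProbabilityMeasure_map hW.aemeasurable
  have : IsProbabilityMeasure (P.map fun ω => (h ω, Y ω)) :=
    Measure.isProbabilityMeasure_map hhY'.aemeasurable
  have hG : Measurable fun z : (ℝ × ℝ) × β => z.1.1 * F (z.1.2, z.2) := by fun_prop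
  have hint : Integrable (fun z : (ℝ × ℝ) × β => z.1.1 * F (z.1.2, z.2))
      ((P.map fun ω => (h ω, Y ω)).prod (P.map W)) := by
    rw [← hmap, integrable_map_measure hG.aestronglyMeasurable (hhY'.prodMk hW).aemeasurable]
    refine Integrable.of_bound (hG.comp (hhY'.prodMk hW)).aestronglyMeasurable (C * D)
      (ae_of_all _ fun ω => ?_)
    simp only [Function.comp, norm_mul, Real.norm_eq_abs]
    exact mul_le_mul (hC ω) (hD _) (abs_nonneg _) ((abs_nonneg _).trans (hC ω))
  calc ∫ ω, h ω * F (Y ω, W ω) ∂P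
      = ∫ z, z.1.1 * F (z.1.2, z.2) ∂(P.map fun ω => ((h ω, Y ω), W ω)) :=
        (integral_map (hhY'.prodMk hW).aemeasurable hG.aestronglyMeasurable).symm
    _ = ∫ p, ∫ w, p.1 * F (p.2, w) ∂(P.map W) ∂(P.map fun ω => (h ω, Y ω)) := by
        rw [hmap, integral_prod _ hint]
    _ = ∫ p, p.1 * ∫ w, F (p.2, w) ∂(P.map W) ∂(P.map fun ω => (h ω, Y ω)) := by
        simp_rw [integral_const_mul]
    _ = _ := by
        refine integral_map (f := fun p : ℝ × ℝ => p.1 * ∫ w, F (p.2, w) ∂(P.map W))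
          hhY'.aemeasurable ?_
        refine (measurable_fst.stronglyMeasurable.mul ?_).aestronglyMeasurable
        exact StronglyMeasurable.integral_prod_right
          (f := fun (p : ℝ × ℝ) w => F (p.2, w)) (by fun_prop : Measurable _).stronglyMeasurable

variable {Ω : Type*} [mΩ : MeasurableSpace Ω] {P : Measure Ω} {ν : Measure ℝ} {r₀ : ℝ}
  {X E : ℕ → Ω → ℝ}

theorem indep_pastSigma (hX : ∀ j, Measurable (X j)) (hE : ∀ j, Measurable (E j))
    (hindep : iIndepFun (Sum.elim X E) P) (n : ℕ) :
    Indep (pastSigma X E n) (MeasurableSpace.comap (fun ω => (E n ω, X n ω)) inferInstance) P := by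
  have hle : ∀ i, MeasurableSpace.comap (Sum.elim X E i) inferInstance ≤ mΩ := by
    rintro (i | i)
    exacts [(hX i).comap_le, (hE i).comap_le]
  have hdisj : Disjoint {i : ℕ ⊕ ℕ | Sum.elim id id i < n} {i | Sum.elim id id i = n} :=
    Set.disjoint_left.2 fun i (h1 : _ < n) (h2 : _ = n) => h1.ne h2
  refine indep_of_indep_of_le_right (indep_iSup_of_disjoint hle hindep hdisj) ?_
  refine Measurable.comap_le (Measurable.prodMk ?_ ?_)
  · exact measurable_iff_comap_le.2 (le_iSup₂_of_le (Sum.inr n) rfl le_rfl)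
  · exact measurable_iff_comap_le.2 (le_iSup₂_of_le (Sum.inl n) rfl le_rfl)

theorem map_sojourn_factor [IsProbabilityMeasure P] (hX_law : ∀ j, HasLaw (X j) ν P)
    (hE_law : ∀ j, HasLaw (E j) (expMeasure 1) P) (hindep : iIndepFun (Sum.elim X E) P) (n : ℕ) :
    P.map (fun ω => (E n ω, X n ω)) = (expMeasure 1).prod ν := by
  have h : IndepFun (E n) (X n) P := hindep.indepFun (i := Sum.inr n) (j := Sum.inl n) (by simp)
  rw [h.map_prod_eq_prod_map_map (hE_law n).aemeasurable (hX_law n).aemeasurable,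
    (hE_law n).map_eq, (hX_law n).map_eq]

theorem measurable_stopsAt (hX : ∀ j, Measurable (X j)) (hE : ∀ j, Measurable (E j))
    (hX_mem : ∀ j ω, X j ω ∈ Set.Ioo (0 : ℝ) 1) (hE_pos : ∀ j ω, 0 < E j ω) (hr₀ : 0 < r₀)
    {π : Ω → WithTop ℝ≥0} (hπ : IsStoppingTime (recordFiltration r₀ hX hE) π) (n : ℕ) :
    Measurable[pastSigma X E (n + 1)] (stopsAt r₀ X E π n) :=
  Measurable.indicator (@measurable_const _ _ _ (pastSigma X E (n + 1)) 1)
    (measurableSet_eq_recordTimeNN hX hE hX_mem hE_pos hr₀ hπ n)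

theorem measurable_passes (hX : ∀ j, Measurable (X j)) (hE : ∀ j, Measurable (E j))
    (hX_mem : ∀ j ω, X j ω ∈ Set.Ioo (0 : ℝ) 1) (hE_pos : ∀ j ω, 0 < E j ω) (hr₀ : 0 < r₀)
    {π : Ω → WithTop ℝ≥0} (hπ : IsStoppingTime (recordFiltration r₀ hX hE) π) (n : ℕ) :
    Measurable[pastSigma X E (n + 1)] (passes r₀ X E π n) := by
  refine Measurable.const_sub (Finset.measurable_fun_sum _ fun m hm => ?_) 1
  exact (measurable_stopsAt hX hE hX_mem hE_pos hr₀ hπ m).mono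
    (pastSigma_mono (Finset.mem_range.1 hm)) le_rfl

end Probability

/-! ### The success event, split by record. -/

section Success

variable {Ω : Type*} [mΩ : MeasurableSpace Ω] {P : Measure Ω} {r₀ : ℝ} {X E : ℕ → Ω → ℝ}

/-- The event that a policy stops at the `(n+1)`-st record and this is the last one before the
horizon. -/
def successAt (r₀ : ℝ) (X E : ℕ → Ω → ℝ) (T : ℝ) (π : Ω → WithTop ℝ≥0) (n : ℕ) : Set Ω :=
  {ω | π ω = recordTimeNN r₀ X E (n + 1) ω} ∩
    {ω | 0 < recordLoad r₀ X E T (n + 1) ω ∧ recordLoad r₀ X E T (n + 1) ω < E (n + 1) ω}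

theorem successProb_eq (hX_mem : ∀ j ω, X j ω ∈ Set.Ioo (0 : ℝ) 1) (hE_pos : ∀ j ω, 0 < E j ω)
    (hr₀ : 0 < r₀) (T : ℝ≥0) (π : Ω → WithTop ℝ≥0) :
    successProb P (recordProcess r₀ X E) T π = P.real (⋃ n, successAt r₀ X E T π n) := by
  rw [successProb]
  congr 1
  ext ω
  simp only [Set.mem_iUnion]
  exact success_iff hr₀ (fun j => hX_mem j ω) (fun j => hE_pos j ω)

end Success

/-! ### Comparison of policies and passage to the limit. -/

section Optimality

variable {Ω : Type*} [mΩ : MeasurableSpace Ω] {P : Measure Ω} [IsProbabilityMeasure P]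
  {ν : Measure ℝ} [IsProbabilityMeasure ν] {r₀ : ℝ} {X E : ℕ → Ω → ℝ}

theorem measurable_recordLoad (hX : ∀ j, Measurable (X j)) (hE : ∀ j, Measurable (E j)) (T : ℝ)
    (n : ℕ) : Measurable (recordLoad r₀ X E T n) :=
  (measurable_recordLoad_pastSigma T n).mono (pastSigma_le hX hE n) le_rfl

/-- The expected gain of moving on from the `n`-th record to the next one. -/
theorem integral_mul_stopGain_succ (hX : ∀ j, Measurable (X j)) (hE : ∀ j, Measurable (E j))
    (hX_mem : ∀ j ω, X j ω ∈ Set.Ioo (0 : ℝ) 1) (hr₀ : 0 < r₀)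
    (hX_law : ∀ j, HasLaw (X j) ν P) (hE_law : ∀ j, HasLaw (E j) (expMeasure 1) P)
    (hindep : iIndepFun (Sum.elim X E) P) (hν : ∀ᵐ x ∂ν, x ∈ Set.Ioo (0 : ℝ) 1) (T : ℝ) {n : ℕ}
    {h : Ω → ℝ} (hh : Measurable[pastSigma X E n] h) {C : ℝ} (hC : ∀ ω, |h ω| ≤ C) :
    ∫ ω, h ω * stopGain (recordLoad r₀ X E T (n + 1) ω) ∂P =
      ∫ ω, h ω * (stopGain (recordLoad r₀ X E T n ω) *
        ∫ x, (Real.exp (recordLoad r₀ X E T n ω * (1 - x)) - 1) / (1 - x) ∂ν) ∂P := by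
  have := integral_mul_comp_of_indep (pastSigma_le hX hE n) ((hE n).prodMk (hX n))
    (indep_pastSigma hX hE hindep n) hh (measurable_recordLoad_pastSigma (r₀ := r₀) T n) hC
    (F := fun z : ℝ × (ℝ × ℝ) => stopGain ((z.1 - z.2.1) * z.2.2))
    (measurable_stopGain.comp (by fun_prop)) (D := 1)
    (fun z => by rw [abs_of_nonneg (stopGain_nonneg _)]; exact stopGain_le_one _)
  rw [map_sojourn_factor hX_law hE_law hindep] at this
  simp only [integral_stopGain_prod hν] at this
  rw [← this]
  refine integral_congr_ae (ae_of_all _ fun ω => ?_)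
  simp only [recordLoad_succ hr₀ (fun j => hX_mem j ω)]

/-- Given the past, the `n`-th record is the last before the horizon with probability `stopGain` of
its load. -/
theorem integral_mul_indicator_last (hX : ∀ j, Measurable (X j)) (hE : ∀ j, Measurable (E j))
    (hX_law : ∀ j, HasLaw (X j) ν P) (hE_law : ∀ j, HasLaw (E j) (expMeasure 1) P)
    (hindep : iIndepFun (Sum.elim X E) P) (T : ℝ) {n : ℕ}
    {h : Ω → ℝ} (hh : Measurable[pastSigma X E n] h) {C : ℝ} (hC : ∀ ω, |h ω| ≤ C) :
    ∫ ω, h ω * (if 0 < recordLoad r₀ X E T n ω ∧ recordLoad r₀ X E T n ω < E n ω then 1 else 0) ∂P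
      = ∫ ω, h ω * stopGain (recordLoad r₀ X E T n ω) ∂P := by
  have := integral_mul_comp_of_indep (pastSigma_le hX hE n) ((hE n).prodMk (hX n))
    (indep_pastSigma hX hE hindep n) hh (measurable_recordLoad_pastSigma (r₀ := r₀) T n) hC
    (F := fun z : ℝ × (ℝ × ℝ) => if 0 < z.1 ∧ z.1 < z.2.1 then 1 else 0)
    (Measurable.ite ((measurableSet_lt measurable_const measurable_fst).inter
      (measurableSet_lt measurable_fst measurable_snd.fst)) measurable_const measurable_const)
    (D := 1) (fun z => by split_ifs <;> simp)
  rw [map_sojourn_factor hX_law hE_law hindep] at this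
  simpa only [integral_indicator_lt_expMeasure] using this

theorem integrable_mul_stopGain (hX : ∀ j, Measurable (X j)) (hE : ∀ j, Measurable (E j)) (T : ℝ)
    {h : Ω → ℝ} (hh : Measurable h) {C : ℝ} (hC : ∀ ω, |h ω| ≤ C) (n : ℕ) :
    Integrable (fun ω => h ω * stopGain (recordLoad r₀ X E T n ω)) P := by
  refine Integrable.of_bound (hh.mul (measurable_stopGain.comp
    (measurable_recordLoad hX hE T n))).aestronglyMeasurable (C * 1) (ae_of_all _ fun ω => ?_)
  rw [norm_mul, Real.norm_eq_abs, Real.norm_of_nonneg (stopGain_nonneg _)]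
  exact mul_le_mul (hC ω) (stopGain_le_one _) (stopGain_nonneg _) ((abs_nonneg _).trans (hC ω))

/-- The integral over `ν` is unbounded in the load, but its product with `stopGain` is a mean of
values of `stopGain`, hence at most 1. -/
theorem integrable_mul_drift (hX : ∀ j, Measurable (X j)) (hE : ∀ j, Measurable (E j))
    (hν : ∀ᵐ x ∂ν, x ∈ Set.Ioo (0 : ℝ) 1) (T : ℝ)
    {h : Ω → ℝ} (hh : Measurable h) {C : ℝ} (hC : ∀ ω, |h ω| ≤ C) (n : ℕ) :
    Integrable (fun ω => h ω * (stopGain (recordLoad r₀ X E T n ω) *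
      ∫ x, (Real.exp (recordLoad r₀ X E T n ω * (1 - x)) - 1) / (1 - x) ∂ν)) P := by
  have := isProbabilityMeasure_expMeasure one_pos
  simp only [← integral_stopGain_prod hν]
  have hk : Measurable fun y : ℝ =>
      ∫ w : ℝ × ℝ, stopGain ((y - w.1) * w.2) ∂((expMeasure 1).prod ν) :=
    (StronglyMeasurable.integral_prod_right
      (f := fun (y : ℝ) (w : ℝ × ℝ) => stopGain ((y - w.1) * w.2))
      (measurable_stopGain.comp (by fun_prop : Measurable _)).stronglyMeasurable).measurable
  refine Integrable.of_bound (hh.mul (hk.comp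
    (measurable_recordLoad hX hE T n))).aestronglyMeasurable (C * 1) (ae_of_all _ fun ω => ?_)
  rw [norm_mul, Real.norm_eq_abs]
  refine mul_le_mul (hC ω) ?_ (norm_nonneg _) ((abs_nonneg _).trans (hC ω))
  refine (norm_integral_le_of_norm_le_const (C := 1) (ae_of_all _ fun w => ?_)).trans_eq (by simp)
  rw [Real.norm_of_nonneg (stopGain_nonneg _)]
  exact stopGain_le_one _

theorem integrable_stopsAt_mul (hX : ∀ j, Measurable (X j)) (hE : ∀ j, Measurable (E j))
    (hX_mem : ∀ j ω, X j ω ∈ Set.Ioo (0 : ℝ) 1) (hE_pos : ∀ j ω, 0 < E j ω) (hr₀ : 0 < r₀)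
    {π : Ω → WithTop ℝ≥0} (hπ : IsStoppingTime (recordFiltration r₀ hX hE) π) (T : ℝ) (m n : ℕ) :
    Integrable (fun ω => stopsAt r₀ X E π m ω * stopGain (recordLoad r₀ X E T n ω)) P := by
  refine integrable_mul_stopGain hX hE T ((measurable_stopsAt hX hE hX_mem hE_pos hr₀ hπ m).mono
    (pastSigma_le hX hE _) le_rfl) (C := 1) (fun ω => ?_) n
  rw [abs_of_nonneg (stopsAt_nonneg _ _ _)]
  exact stopsAt_le_one _ _ _

theorem integrable_passes_mul (hX : ∀ j, Measurable (X j)) (hE : ∀ j, Measurable (E j))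
    (hX_mem : ∀ j ω, X j ω ∈ Set.Ioo (0 : ℝ) 1) (hE_pos : ∀ j ω, 0 < E j ω) (hr₀ : 0 < r₀)
    {π : Ω → WithTop ℝ≥0} (hπ : IsStoppingTime (recordFiltration r₀ hX hE) π) (T : ℝ) (m n : ℕ) :
    Integrable (fun ω => passes r₀ X E π m ω * stopGain (recordLoad r₀ X E T n ω)) P := by
  refine integrable_mul_stopGain hX hE T ((measurable_passes hX hE hX_mem hE_pos hr₀ hπ m).mono
    (pastSigma_le hX hE _) le_rfl) (C := 1) (fun ω => ?_) n
  have := passes_mem_Icc hX_mem hE_pos hr₀ π m ω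
  rw [abs_of_nonneg this.1]
  exact this.2

theorem integrable_truncatedGain (hX : ∀ j, Measurable (X j)) (hE : ∀ j, Measurable (E j))
    (hX_mem : ∀ j ω, X j ω ∈ Set.Ioo (0 : ℝ) 1) (hE_pos : ∀ j ω, 0 < E j ω) (hr₀ : 0 < r₀)
    {π : Ω → WithTop ℝ≥0} (hπ : IsStoppingTime (recordFiltration r₀ hX hE) π) (T : ℝ) (n : ℕ) :
    Integrable (truncatedGain r₀ X E T π n) P :=
  (integrable_finsetSum _ fun m _ =>
    integrable_stopsAt_mul hX hE hX_mem hE_pos hr₀ hπ T m (m + 1)).add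
      (integrable_passes_mul hX hE hX_mem hE_pos hr₀ hπ T n (n + 1))

theorem integral_truncatedGain (hX : ∀ j, Measurable (X j)) (hE : ∀ j, Measurable (E j))
    (hX_mem : ∀ j ω, X j ω ∈ Set.Ioo (0 : ℝ) 1) (hE_pos : ∀ j ω, 0 < E j ω) (hr₀ : 0 < r₀)
    {π : Ω → WithTop ℝ≥0} (hπ : IsStoppingTime (recordFiltration r₀ hX hE) π) (T : ℝ) (n : ℕ) :
    ∫ ω, truncatedGain r₀ X E T π n ω ∂P =
      ∑ m ∈ Finset.range (n + 1),
        ∫ ω, stopsAt r₀ X E π m ω * stopGain (recordLoad r₀ X E T (m + 1) ω) ∂P +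
      ∫ ω, passes r₀ X E π n ω * stopGain (recordLoad r₀ X E T (n + 1) ω) ∂P := by
  have hi := fun m => integrable_stopsAt_mul (P := P) hX hE hX_mem hE_pos hr₀ hπ T m (m + 1)
  simp only [truncatedGain]
  rw [integral_add (integrable_finsetSum _ fun m _ => hi m)
    (integrable_passes_mul hX hE hX_mem hE_pos hr₀ hπ T n (n + 1)),
    integral_finsetSum _ fun m _ => hi m]

/-- Moving on is favourable exactly while the load exceeds the critical threshold, so the
threshold policy has the largest truncated gain. -/
theorem integral_truncatedGain_le (hX : ∀ j, Measurable (X j)) (hE : ∀ j, Measurable (E j))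
    (hX_mem : ∀ j ω, X j ω ∈ Set.Ioo (0 : ℝ) 1) (hE_pos : ∀ j ω, 0 < E j ω) (hr₀ : 0 < r₀)
    (hX_law : ∀ j, HasLaw (X j) ν P) (hE_law : ∀ j, HasLaw (E j) (expMeasure 1) P)
    (hindep : iIndepFun (Sum.elim X E) P) (hν : ∀ᵐ x ∂ν, x ∈ Set.Ioo (0 : ℝ) 1) {s : ℝ}
    (hs : 0 < s) (hs1 : ∫ x, (Real.exp (s * (1 - x)) - 1) / (1 - x) ∂ν = 1) (T : ℝ≥0)
    {π : Ω → WithTop ℝ≥0} (hπ : IsStoppingTime (recordFiltration r₀ hX hE) π) (n : ℕ) :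
    ∫ ω, truncatedGain r₀ X E T π n ω ∂P ≤
      ∫ ω, truncatedGain r₀ X E T (thresholdPolicy (recordProcess r₀ X E) T s) n ω ∂P := by
  have hτ := isStoppingTime_thresholdPolicy hX hE hX_mem hE_pos hr₀ T s
  set τ := thresholdPolicy (recordProcess r₀ X E) T s with hτ_def
  induction n with
  -- Both policies are forced to stop at the first record at the latest, so their gains coincide.
  | zero => simp only [truncatedGain_zero, le_refl]
  | succ n ih =>
    have hpass := fun {σ : Ω → WithTop ℝ≥0}
        (hσ : IsStoppingTime (recordFiltration r₀ hX hE) σ) k =>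
      integrable_passes_mul (P := P) hX hE hX_mem hE_pos hr₀ hσ T n k
    have hgain := fun {σ : Ω → WithTop ℝ≥0}
        (hσ : IsStoppingTime (recordFiltration r₀ hX hE) σ) =>
      integrable_truncatedGain (P := P) hX hE hX_mem hE_pos hr₀ hσ T n
    have hstep : ∀ σ : Ω → WithTop ℝ≥0, IsStoppingTime (recordFiltration r₀ hX hE) σ →
        ∫ ω, truncatedGain r₀ X E T σ (n + 1) ω ∂P = ∫ ω, truncatedGain r₀ X E T σ n ω ∂P +
          (∫ ω, passes r₀ X E σ n ω * stopGain (recordLoad r₀ X E T (n + 2) ω) ∂P -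
            ∫ ω, passes r₀ X E σ n ω * stopGain (recordLoad r₀ X E T (n + 1) ω) ∂P) := by
      intro σ hσ
      simp only [truncatedGain_succ, mul_sub]
      rw [← integral_sub (hpass hσ _) (hpass hσ _)]
      exact integral_add (hgain hσ) ((hpass hσ _).sub (hpass hσ _))
    rw [hstep π hπ, hstep τ hτ]
    refine add_le_add ih ?_
    -- It remains to show that waiting does not decrease the mean of the gain weighted by `h`. The
    -- sign of `h` agrees with that of the drift: `h ≤ 0` for loads up to `s`, `h ≥ 0` above.
    set h : Ω → ℝ := fun ω => passes r₀ X E τ n ω - passes r₀ X E π n ω with h_def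
    have hh : Measurable[pastSigma X E (n + 1)] h :=
      (measurable_passes hX hE hX_mem hE_pos hr₀ hτ n).sub
        (measurable_passes hX hE hX_mem hE_pos hr₀ hπ n)
    have hC : ∀ ω, |h ω| ≤ 1 := by
      intro ω
      have h1 := passes_mem_Icc hX_mem hE_pos hr₀ τ n ω
      have h2 := passes_mem_Icc hX_mem hE_pos hr₀ π n ω
      exact abs_sub_le_iff.2 ⟨by linarith [h1.2, h2.1], by linarith [h2.2, h1.1]⟩
    have hint : ∀ k, ∫ ω, h ω * stopGain (recordLoad r₀ X E T k ω) ∂P =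
        ∫ ω, passes r₀ X E τ n ω * stopGain (recordLoad r₀ X E T k ω) ∂P -
          ∫ ω, passes r₀ X E π n ω * stopGain (recordLoad r₀ X E T k ω) ∂P := by
      intro k
      simp only [h_def, sub_mul]
      exact integral_sub (hpass hτ k) (hpass hπ k)
    have hdrift := integral_mul_stopGain_succ hX hE hX_mem hr₀ hX_law hE_law hindep hν T hh hC
    have hmono : ∫ ω, h ω * stopGain (recordLoad r₀ X E T (n + 1) ω) ∂P ≤
        ∫ ω, h ω * stopGain (recordLoad r₀ X E T (n + 1 + 1) ω) ∂P := by
      have hh' : Measurable h := hh.mono (pastSigma_le hX hE _) le_rfl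
      rw [hdrift]
      refine integral_mono (integrable_mul_stopGain hX hE T hh' hC (n + 1))
        (integrable_mul_drift hX hE hν T hh' hC (n + 1)) fun ω => ?_
      have h1 := passes_mem_Icc hX_mem hE_pos hr₀ π n ω
      have h2 := passes_thresholdPolicy hX_mem hE_pos hr₀ T hs.le n ω
      have hgn := stopGain_nonneg (recordLoad r₀ X E T (n + 1) ω)
      simp only [h_def, h2, hτ_def]
      -- Past the horizon both sides vanish; monotonicity of the critical function is available only
      -- for nonnegative loads.
      rcases le_or_gt (recordLoad r₀ X E T (n + 1) ω) 0 with h0 | h0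
      · simp [stopGain_of_nonpos h0]
      split_ifs with hY
      · have h3 := sub_le_integral_exp_quotient_sub hν h0.le hY
        refine mul_le_mul_of_nonpos_left (mul_le_of_le_one_right hgn ?_) (by linarith [h1.1])
        linarith
      · have h3 := sub_le_integral_exp_quotient_sub hν hs.le (not_le.1 hY).le
        refine mul_le_mul_of_nonneg_left (le_mul_of_one_le_right hgn ?_) (by linarith [h1.2])
        linarith [not_le.1 hY]
    have h1 := hint (n + 1)
    have h2 := hint (n + 2)
    linarith

/-- Almost surely only finitely many records occur before the horizon. -/
theorem tendsto_measureReal_recordLoad_pos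
    (hX_mem : ∀ j ω, X j ω ∈ Set.Ioo (0 : ℝ) 1) (hE_pos : ∀ j ω, 0 < E j ω) (hr₀ : 0 < r₀)
    (hE_law : ∀ j, HasLaw (E j) (expMeasure 1) P)
    (hindep : iIndepFun (Sum.elim X E) P) (T : ℝ≥0) :
    Tendsto (fun n => P.real {ω | 0 < recordLoad r₀ X E T n ω}) atTop (𝓝 0) := by
  have := isProbabilityMeasure_expMeasure one_pos
  set c : ℝ := T * r₀
  have hc : 0 ≤ c := mul_nonneg T.2 hr₀.le
  have hE_indep : iIndepFun E P := by
    simpa [Function.comp_def] using iIndepFun.precomp (g := Sum.inr) Sum.inr_injective hindep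
  -- A positive `n`-th load forces `n` independent sojourns below `c`, whence geometric decay.
  have hbound : ∀ n, P.real {ω | 0 < recordLoad r₀ X E T n ω} ≤ (1 - Real.exp (-c)) ^ n := by
    intro n
    have hsub : {ω | 0 < recordLoad r₀ X E T n ω} ⊆
        ⋂ j ∈ Finset.range n, E j ⁻¹' Set.Iic c := by
      intro ω hω
      simp only [Set.mem_iInter, Finset.mem_range]
      exact fun j hj => sojourn_le_of_recordLoad_pos hX_mem hE_pos hr₀ T n ω hω hj
    refine (measureReal_mono hsub).trans_eq ?_
    rw [measureReal_def, hE_indep.measure_inter_preimage_eq_mul _ fun _ _ => measurableSet_Iic,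
      ENNReal.toReal_prod]
    have hfac : ∀ j, (P (E j ⁻¹' Set.Iic c)).toReal = 1 - Real.exp (-c) := by
      intro j
      rw [← Measure.map_apply_of_aemeasurable (hE_law j).aemeasurable measurableSet_Iic,
        (hE_law j).map_eq, ← measureReal_def, ← cdf_eq_real, cdf_expMeasure_eq one_pos, if_pos hc,
        one_mul]
    simp [hfac]
  refine squeeze_zero (fun _ => measureReal_nonneg) hbound
    (tendsto_pow_atTop_nhds_zero_of_lt_one ?_ ?_)
  · linarith [Real.exp_le_one_iff.2 (neg_nonpos.2 hc)]
  · linarith [Real.exp_pos (-c)]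

theorem measurableSet_successAt (hX : ∀ j, Measurable (X j)) (hE : ∀ j, Measurable (E j))
    (hX_mem : ∀ j ω, X j ω ∈ Set.Ioo (0 : ℝ) 1) (hE_pos : ∀ j ω, 0 < E j ω) (hr₀ : 0 < r₀)
    {π : Ω → WithTop ℝ≥0} (hπ : IsStoppingTime (recordFiltration r₀ hX hE) π) (T : ℝ) (n : ℕ) :
    MeasurableSet (successAt r₀ X E T π n) := by
  have hY := measurable_recordLoad (r₀ := r₀) hX hE T (n + 1)
  exact (pastSigma_le hX hE _ _ (measurableSet_eq_recordTimeNN hX hE hX_mem hE_pos hr₀ hπ n)).inter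
    ((measurableSet_lt measurable_const hY).inter (measurableSet_lt hY (hE _)))

theorem measureReal_successAt (hX : ∀ j, Measurable (X j)) (hE : ∀ j, Measurable (E j))
    (hX_mem : ∀ j ω, X j ω ∈ Set.Ioo (0 : ℝ) 1) (hE_pos : ∀ j ω, 0 < E j ω) (hr₀ : 0 < r₀)
    (hX_law : ∀ j, HasLaw (X j) ν P) (hE_law : ∀ j, HasLaw (E j) (expMeasure 1) P)
    (hindep : iIndepFun (Sum.elim X E) P)
    {π : Ω → WithTop ℝ≥0} (hπ : IsStoppingTime (recordFiltration r₀ hX hE) π) (T : ℝ) (n : ℕ) :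
    P.real (successAt r₀ X E T π n) =
      ∫ ω, stopsAt r₀ X E π n ω * stopGain (recordLoad r₀ X E T (n + 1) ω) ∂P := by
  rw [← integral_mul_indicator_last hX hE hX_law hE_law hindep T
    (measurable_stopsAt hX hE hX_mem hE_pos hr₀ hπ n) (C := 1) (fun ω => by
      rw [abs_of_nonneg (stopsAt_nonneg _ _ _)]; exact stopsAt_le_one _ _ _),
    ← integral_indicator_one (measurableSet_successAt hX hE hX_mem hE_pos hr₀ hπ T n)]
  refine integral_congr_ae (ae_of_all _ fun ω => ?_)
  rw [successAt, Set.inter_indicator_one, Pi.mul_apply]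
  exact congrArg _ (by classical exact Set.indicator_apply _ _ _)

theorem integral_passes_mul_mem_Icc (hX : ∀ j, Measurable (X j)) (hE : ∀ j, Measurable (E j))
    (hX_mem : ∀ j ω, X j ω ∈ Set.Ioo (0 : ℝ) 1) (hE_pos : ∀ j ω, 0 < E j ω) (hr₀ : 0 < r₀)
    {π : Ω → WithTop ℝ≥0} (hπ : IsStoppingTime (recordFiltration r₀ hX hE) π) (T : ℝ) (n : ℕ) :
    ∫ ω, passes r₀ X E π n ω * stopGain (recordLoad r₀ X E T (n + 1) ω) ∂P ∈
      Set.Icc 0 (P.real {ω | 0 < recordLoad r₀ X E T (n + 1) ω}) := by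
  have hp := passes_mem_Icc hX_mem hE_pos hr₀ π n
  refine ⟨integral_nonneg fun ω => mul_nonneg (hp ω).1 (stopGain_nonneg _), ?_⟩
  have hmeas : MeasurableSet {ω | 0 < recordLoad r₀ X E T (n + 1) ω} :=
    measurableSet_lt measurable_const (measurable_recordLoad hX hE T (n + 1))
  rw [← integral_indicator_one hmeas]
  refine integral_mono (integrable_passes_mul hX hE hX_mem hE_pos hr₀ hπ T n (n + 1))
    ((integrable_const 1).indicator hmeas) fun ω => ?_
  rcases le_or_gt (recordLoad r₀ X E T (n + 1) ω) 0 with h | h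
  · simp only [stopGain_of_nonpos h, mul_zero]
    exact Set.indicator_nonneg (fun _ _ => zero_le_one) _
  · rw [Set.indicator_of_mem (show ω ∈ {ω | 0 < recordLoad r₀ X E T (n + 1) ω} from h)]
    exact mul_le_one₀ (hp ω).2 (stopGain_nonneg _) (stopGain_le_one _)

/-- Success at a record after the `(n+1)`-st requires positive load already there. -/
theorem successProb_le_add (hX : ∀ j, Measurable (X j)) (hE : ∀ j, Measurable (E j))
    (hX_mem : ∀ j ω, X j ω ∈ Set.Ioo (0 : ℝ) 1) (hE_pos : ∀ j ω, 0 < E j ω) (hr₀ : 0 < r₀)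
    (hX_law : ∀ j, HasLaw (X j) ν P) (hE_law : ∀ j, HasLaw (E j) (expMeasure 1) P)
    (hindep : iIndepFun (Sum.elim X E) P) (T : ℝ≥0)
    {π : Ω → WithTop ℝ≥0} (hπ : IsStoppingTime (recordFiltration r₀ hX hE) π) (n : ℕ) :
    successProb P (recordProcess r₀ X E) T π ≤ ∫ ω, truncatedGain r₀ X E T π n ω ∂P +
      P.real {ω | 0 < recordLoad r₀ X E T (n + 1) ω} := by
  rw [successProb_eq hX_mem hE_pos hr₀, integral_truncatedGain hX hE hX_mem hE_pos hr₀ hπ]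
  have hsub : ⋃ m, successAt r₀ X E T π m ⊆
      (⋃ m ∈ Finset.range (n + 1), successAt r₀ X E T π m) ∪
        {ω | 0 < recordLoad r₀ X E T (n + 1) ω} := by
    refine Set.iUnion_subset fun m ω hω => ?_
    rcases lt_or_ge m (n + 1) with h | h
    · exact Or.inl (Set.mem_biUnion (Finset.mem_range.2 h) hω)
    · right
      by_contra hcon
      exact absurd hω.2.1 (not_lt.2 (recordLoad_le_of_le hr₀ (fun j => hX_mem j ω)
        (fun j => hE_pos j ω) le_rfl (by omega) (not_lt.1 hcon)))
  have h1 := (measureReal_mono hsub (μ := P)).trans (measureReal_union_le _ _)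
  have h2 := measureReal_biUnion_finset_le (μ := P) (Finset.range (n + 1))
    (successAt r₀ X E T π)
  simp only [measureReal_successAt hX hE hX_mem hE_pos hr₀ hX_law hE_law hindep hπ] at h2
  have h3 := (integral_passes_mul_mem_Icc (P := P) hX hE hX_mem hE_pos hr₀ hπ T n).1
  linarith

/-- The success events at different records are disjoint, and the forced final stop gains something
only under positive load. -/
theorem integral_truncatedGain_le_successProb_add (hX : ∀ j, Measurable (X j))
    (hE : ∀ j, Measurable (E j))
    (hX_mem : ∀ j ω, X j ω ∈ Set.Ioo (0 : ℝ) 1) (hE_pos : ∀ j ω, 0 < E j ω) (hr₀ : 0 < r₀)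
    (hX_law : ∀ j, HasLaw (X j) ν P) (hE_law : ∀ j, HasLaw (E j) (expMeasure 1) P)
    (hindep : iIndepFun (Sum.elim X E) P) (T : ℝ≥0)
    {π : Ω → WithTop ℝ≥0} (hπ : IsStoppingTime (recordFiltration r₀ hX hE) π) (n : ℕ) :
    ∫ ω, truncatedGain r₀ X E T π n ω ∂P ≤ successProb P (recordProcess r₀ X E) T π +
      P.real {ω | 0 < recordLoad r₀ X E T (n + 1) ω} := by
  rw [successProb_eq hX_mem hE_pos hr₀, integral_truncatedGain hX hE hX_mem hE_pos hr₀ hπ]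
  refine add_le_add ?_ (integral_passes_mul_mem_Icc hX hE hX_mem hE_pos hr₀ hπ T n).2
  have hdisj : Pairwise (Function.onFun Disjoint (successAt r₀ X E T π)) := by
    intro i j hij
    refine Set.disjoint_left.2 fun ω hi hj => hij ?_
    have hij' : i + 1 = j + 1 :=
      (recordTimeNN_strictMono hr₀ (fun j => hX_mem j ω) (fun j => hE_pos j ω)).injective
        (WithTop.coe_injective (hi.1.symm.trans hj.1))
    omega
  have h := measureReal_biUnion_finset (μ := P) (s := Finset.range (n + 1))
    (hdisj.set_pairwise _)
    (fun m _ => measurableSet_successAt hX hE hX_mem hE_pos hr₀ hπ T m)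
  simp only [measureReal_successAt hX hE hX_mem hE_pos hr₀ hX_law hE_law hindep hπ] at h
  rw [← h]
  exact measureReal_mono (Set.iUnion₂_subset_iUnion _ _)

end Optimality

/-- `X 0, X 1, …` are i.i.d. factors with law `ν` in `]0,1[`, and `E 0, E 1, …` are i.i.d. unit
exponential variables independent of them. -/
theorem mainTheorem1 {Ω : Type*} [MeasurableSpace Ω] (P : Measure Ω) [IsProbabilityMeasure P]
    (ν : Measure ℝ) (X E : ℕ → Ω → ℝ)
    (hX : ∀ j, Measurable (X j)) (hE : ∀ j, Measurable (E j))
    (hX_mem : ∀ j ω, X j ω ∈ Set.Ioo (0 : ℝ) 1) (hE_pos : ∀ j ω, 0 < E j ω)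
    (hX_law : ∀ j, HasLaw (X j) ν P) (hE_law : ∀ j, HasLaw (E j) (expMeasure 1) P)
    (hindep : iIndepFun (Sum.elim X E) P)
    (r₀ : ℝ) (hr₀ : 0 < r₀) (T : ℝ≥0) :
    (∃! s : ℝ, 0 < s ∧ ∫ x, (Real.exp (s * (1 - x)) - 1) / (1 - x) ∂ν = 1) ∧
    ∀ s : ℝ, 0 < s → ∫ x, (Real.exp (s * (1 - x)) - 1) / (1 - x) ∂ν = 1 →
      IsStoppingTime (recordFiltration r₀ hX hE)
        (thresholdPolicy (recordProcess r₀ X E) T s) ∧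
      ∀ π : Ω → WithTop ℝ≥0, IsStoppingTime (recordFiltration r₀ hX hE) π →
        successProb P (recordProcess r₀ X E) T π ≤
          successProb P (recordProcess r₀ X E) T
            (thresholdPolicy (recordProcess r₀ X E) T s) := by

  have : IsProbabilityMeasure ν := (hX_law 0).isProbabilityMeasure_iff.1 inferInstance
  have hν : ∀ᵐ x ∂ν, x ∈ Set.Ioo (0 : ℝ) 1 := by
    rw [← (hX_law 0).map_eq]
    refine (ae_map_iff (hX 0).aemeasurable measurableSet_Ioo).2 ?_
    exact ae_of_all _ (hX_mem 0)
  refine ⟨existsUnique_integral_exp_quotient_eq_one hν, fun s hs hs1 => ?_⟩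
  have hτ := isStoppingTime_thresholdPolicy hX hE hX_mem hE_pos hr₀ T s
  refine ⟨hτ, fun π hπ => ?_⟩
  have hlim := (tendsto_measureReal_recordLoad_pos (P := P) hX_mem hE_pos hr₀ hE_law hindep
    T).comp (tendsto_add_atTop_nat 1)
  -- The factor 2 counts one truncation error for `π` and one for the threshold policy.
  have hlim' := (hlim.const_mul 2).const_add (successProb P (recordProcess r₀ X E) T
    (thresholdPolicy (recordProcess r₀ X E) T s))
  rw [mul_zero, add_zero] at hlim'
  refine ge_of_tendsto' hlim' fun n => ?_
  have h1 := successProb_le_add hX hE hX_mem hE_pos hr₀ hX_law hE_law hindep T hπ n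
  have h2 := integral_truncatedGain_le hX hE hX_mem hE_pos hr₀ hX_law hE_law hindep hν hs hs1 T
    hπ n
  have h3 := integral_truncatedGain_le_successProb_add hX hE hX_mem hE_pos hr₀ hX_law hE_law
    hindep T hτ n
  simp only [Function.comp]
  linarith
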